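/- Let $G$ be a Lie group of dimension $n$ with a left invariant sub-Riemannian structure of step two: $X_1,\dots,X_n$ is a basis of left invariant vector fields whose first $m$ members are the orthonormal horizontal frame, and $X_i$, $[X_i,X_j]$ ($1\le i,j\le m$) span the Lie algebra. For $\epsilon>0$ put $X_i^\epsilon=X_i$ for $i\le m$ and $X_i^\epsilon=\epsilon X_i$ for $i>m$, and for a function $f$ on an open subset of $G$ let $$|\nabla_\epsilon f|^2=\sum_{i=1}^n (X_i^\epsilon f)^2,\qquad W_\epsilon=\sqrt{1+|\nabla_\epsilon f|^2},\qquad h_\epsilon=\sum_{i=1}^n X_i^\epsilon\Big(\frac{X_i^\epsilon f}{W_\epsilon}\Big).$$ For an open set $\Omega\subset G$ and $0<T<\infty$ let $Q=\Omega\times(0,T)$ and $\partial_pQ=(\Omega\times\{0\})\cup(\partial\Omega\times(0,T))$. **Proposition.** For every compact set $B\subset G$ there is a constant $C=C(G,X_1,\dots,X_n,m,B)>0$ with the following property. Let $\Omega\subset G$ be an open set contained in some left translate $gB$ of $B$ (so that $\Omega$ is bounded; every bounded $\Omega$ is of this kind), let $0<T<\infty$, $\epsilon>0$, $\varphi:G\to\mathbb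 R$, and let $u_\epsilon\in C^3(Q)\cap C(Q\cup\partial_pQ)$ be a solution of the mean curvature flow $$\partial_t u_\epsilon=h_\epsilon W_\epsilon \ \text{ in } Q,\qquad u_\epsilon(x,t)=\varphi(x)\ \text{ for } (x,t)\in\partial_pQ$$ (with $h_\epsilon$, $W_\epsilon$ computed for $f=u_\epsilon(\cdot,t)$), such that $X_1u_\epsilon,\dots,X_nu_\epsilon$ extend continuously from $Q$ to $\overline\Omega\times[0,T)$ and $\partial_tu_\epsilon$ extends continuously from $Q$ to $Q\cup\partial_pQ$. Then for every compact $K\subset\Omega$ $$\sup_{K\times[0,T)}|\nabla_1u_\epsilon|\ \le\ C\,\sup_{\partial_pQ}\big(|\nabla_1u_\epsilon|+|\partial_tu_\epsilon|\big),$$ where at boundary points the derivatives are the continuous extensions, and the suprema are taken in $[0,\infty]$ (the supremum over the empty set being $0$). In particular $C$ does not depend on $\epsilon$, $T$, $\varphi$, $u_\epsilon$ or $K$. -/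

import Mathlib

open Set Filter Topology
open scoped Manifold ContDiff ENNReal NNReal Pointwise

/-- A left invariant sub-Riemannian structure of step two on the Lie group `G`, given by an adapted
frame: a basis `X 0, …, X (n - 1)` of the Lie algebra, of which the first `m` members are the
orthonormal horizontal frame, such that the horizontal vectors and their brackets span. -/
structure StepTwoFrame (E G : Type*) [NormedAddCommGroup E] [NormedSpace ℝ E]
    [TopologicalSpace G] [ChartedSpace E G] [Group G] (n m : ℕ) where
  X : Module.Basis (Fin n) ℝ (GroupLieAlgebra 𝓘(ℝ, E) G)
  m_le : m ≤ n
  step_two : Submodule.span ℝ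
    ({v | ∃ i : Fin n, i.val < m ∧ v = X i} ∪
      {v | ∃ i j : Fin n, i.val < m ∧ j.val < m ∧ v = ⁅X i, X j⁆}) = ⊤

noncomputable section

namespace MeanCurvatureFlow

variable {E G : Type*} [NormedAddCommGroup E] [NormedSpace ℝ E]
  [TopologicalSpace G] [ChartedSpace E G] [Group G]

/-- The derivative of `f : G → ℝ` along the left invariant vector field generated by `v`. -/
def leftDeriv (v : GroupLieAlgebra 𝓘(ℝ, E) G) (f : G → ℝ) (x : G) : ℝ :=
  (mfderiv 𝓘(ℝ, E) 𝓘(ℝ, ℝ) f x (mulInvariantVectorField v x) : ℝ)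

variable {n m : ℕ}

/-- `X_i^ε f`, where `X_i^ε = X_i` for the horizontal vectors and `X_i^ε = ε X_i` for the others. -/
def frameDeriv (F : StepTwoFrame E G n m) (ε : ℝ) (i : Fin n) (f : G → ℝ) : G → ℝ :=
  leftDeriv ((if i.val < m then (1 : ℝ) else ε) • F.X i) f

/-- `|∇_ε f|`, the length of the gradient of `f` for the Riemannian metric `σ_ε` that makes
`X_1^ε, …, X_n^ε` orthonormal. -/
def gradNorm (F : StepTwoFrame E G n m) (ε : ℝ) (f : G → ℝ) (x : G) : ℝ :=
  Real.sqrt (∑ i, frameDeriv F ε i f x ^ 2)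

/-- `W_ε = (1 + |∇_ε f|²)^{1/2}`. -/
def areaElement (F : StepTwoFrame E G n m) (ε : ℝ) (f : G → ℝ) (x : G) : ℝ :=
  Real.sqrt (1 + ∑ i, frameDeriv F ε i f x ^ 2)

/-- `h_ε = ∑ i, X_i^ε (X_i^ε f / W_ε)`, the mean curvature of the graph of `f`. -/
def meanCurvature (F : StepTwoFrame E G n m) (ε : ℝ) (f : G → ℝ) (x : G) : ℝ :=
  ∑ i, frameDeriv F ε i (fun y => frameDeriv F ε i f y / areaElement F ε f y) x

/-- The open cylinder `Q = Ω × (0, T)`. -/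
def cylinder (Ω : Set G) (T : ℝ) : Set (G × ℝ) := Ω ×ˢ Ioo 0 T

/-- The parabolic boundary `(Ω × {0}) ∪ (∂Ω × (0, T))`. -/
def parabolicBoundary (Ω : Set G) (T : ℝ) : Set (G × ℝ) :=
  (Ω ×ˢ {0}) ∪ (frontier Ω ×ˢ Ioo 0 T)

/-- `f`, given on `A`, has finite limits from within `A` at all points of `B`; its continuous
extension to `A ∪ B` is then `extendFrom A f`. -/
def ExtendsContinuously (A B : Set (G × ℝ)) (f : G × ℝ → ℝ) : Prop :=
  ∀ p ∈ B, ∃ l, Tendsto f (𝓝[A] p) (𝓝 l)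

/-- The left invariant spatial derivative `X_i u` of a function of `(x, t)`. -/
def spaceDeriv (F : StepTwoFrame E G n m) (i : Fin n) (u : G × ℝ → ℝ) (p : G × ℝ) : ℝ :=
  frameDeriv F 1 i (fun x => u (x, p.2)) p.1

/-- The time derivative `∂_t u`. -/
def timeDeriv (u : G × ℝ → ℝ) (p : G × ℝ) : ℝ := deriv (fun s => u (p.1, s)) p.2

/-- `|∇_1 u|` in the cylinder, extended by continuity to its boundary. -/
def spaceGrad (F : StepTwoFrame E G n m) (Ω : Set G) (T : ℝ) (u : G × ℝ → ℝ) : G × ℝ → ℝ :=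
  extendFrom (cylinder Ω T) (fun p => gradNorm F 1 (fun x => u (x, p.2)) p.1)

/-- `|∂_t u|` in the cylinder, extended by continuity to its boundary. -/
def timeSpeed (Ω : Set G) (T : ℝ) (u : G × ℝ → ℝ) : G × ℝ → ℝ :=
  extendFrom (cylinder Ω T) (fun p => |timeDeriv u p|)

/-- `u ∈ C³(Q)` solves the initial-boundary value problem
`∂_t u = h_ε W_ε` in `Q = Ω × (0, T)`, `u = φ` on the parabolic boundary,
and is regular enough up to the boundary for `|∇_1 u|` and `|∂_t u|` to have a meaning there. -/
structure IsSolution (F : StepTwoFrame E G n m) (ε : ℝ) (Ω : Set G) (T : ℝ) (φ : G → ℝ)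
    (u : G × ℝ → ℝ) : Prop where
  smooth : ContMDiffOn (𝓘(ℝ, E).prod 𝓘(ℝ, ℝ)) 𝓘(ℝ, ℝ) 3 u (cylinder Ω T)
  continuousOn : ContinuousOn u (cylinder Ω T ∪ parabolicBoundary Ω T)
  space_extends : ∀ i, ExtendsContinuously (cylinder Ω T) (closure Ω ×ˢ Ico 0 T) (spaceDeriv F i u)
  time_extends : ExtendsContinuously (cylinder Ω T) (parabolicBoundary Ω T) (timeDeriv u)
  equation : ∀ p ∈ cylinder Ω T, timeDeriv u p =
    meanCurvature F ε (fun x => u (x, p.2)) p.1 * areaElement F ε (fun x => u (x, p.2)) p.1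
  boundary : ∀ p ∈ parabolicBoundary Ω T, u p = φ p.1

end MeanCurvatureFlow

end

/-! The equation is built from left invariant fields, so it is preserved by left translations.
Hence, if `R` is the right invariant field generated by a curve of left translations, `R u`
satisfies the linearised equation. That equation is parabolic, and it has no zeroth order term
because the operator sees `u` only through its derivatives. So the weak maximum principle bounds `R
u` in `Q` by its values on the parabolic boundary, with no dependence on `ε`
(`nonpos_of_rightDeriv_sub_le` at an interior maximum, `le_of_le_on_parabolicBoundary` on the
cylinder).

At a point `x` the left and right invariant frames differ by the adjoint action, whose coefficients
are bounded on compact sets. A bound for the left derivatives on the boundary becomes one for the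
right derivatives, the maximum principle carries it inside, and the inverse adjoint action turns it
back into a bound for the gradient (`rightDeriv_eq_leftDeriv`, `conjVector_conjVector_inv`,
`spaceGrad_le_of_bound`).

For the constant to serve all translates `g • B`, the translating curves are conjugated by `g`: the
adjoint action that then appears at `x` is that of `(g⁻¹ * x)⁻¹`, where `g⁻¹ * x` lies in `B`.

The linearised equation is never written out. In the coordinates `flowChart`, with `s` the parameter
of the translations, the equation along the `s`-axis has coefficients independent of `s`, and it is
differentiated at `s = 0` only where the gradient of `R u` vanishes. -/

/-! ### Calculus at a maximum and the trace inequality -/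

/-- A positive second derivative would make `a` a local minimum too, so `h` would be constant near
`a` and its second derivative would vanish. -/
theorem IsLocalMax.deriv_deriv_nonpos {h : ℝ → ℝ} {a : ℝ} (hmax : IsLocalMax h a)
    (hc : ContinuousAt h a) : deriv (deriv h) a ≤ 0 := by
  by_contra! hpos
  have hmin := isLocalMin_of_deriv_deriv_pos hpos hmax.deriv_eq_zero hc
  have hconst : h =ᶠ[𝓝 a] fun _ => h a := by
    filter_upwards [hmax, hmin] with x h1 h2 using le_antisymm h1 h2
  have h0 := hconst.deriv.deriv_eq
  simp at h0
  exact hpos.ne' h0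

section Calculus

variable {V : Type*} [NormedAddCommGroup V] [NormedSpace ℝ V]

theorem hasDerivAt_comp_line {W : Type*} [NormedAddCommGroup W] [NormedSpace ℝ W]
    {f : V → W} {p a : V} {r : ℝ} (hf : DifferentiableAt ℝ f (p + r • a)) :
    HasDerivAt (fun s : ℝ => f (p + s • a)) (fderiv ℝ f (p + r • a) a) r := by
  have hl : HasDerivAt (fun s : ℝ => p + s • a) a r := by
    simpa using ((hasDerivAt_id r).smul_const a).const_add p
  exact hf.hasFDerivAt.comp_hasDerivAt r hl

theorem hasDerivAt_bilin_comp_line {f : V → V →L[ℝ] V →L[ℝ] ℝ} {p e : V}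
    (hf : DifferentiableAt ℝ f p) (a b : V) :
    HasDerivAt (fun s : ℝ => f (p + s • e) a b) (fderiv ℝ f p e a b) 0 := by
  have h1 : HasFDerivAt (fun x => f x a) ((fderiv ℝ f p).flip a) p := by
    simpa using hf.hasFDerivAt.clm_apply (hasFDerivAt_const a p)
  have h2 : HasFDerivAt (fun x => f x a b) (((fderiv ℝ f p).flip a).flip b) p := by
    simpa using h1.clm_apply (hasFDerivAt_const b p)
  have h3 := hasDerivAt_comp_line (p := p) (a := e) (r := 0) (f := fun x => f x a b)
    (by simpa using h2.differentiableAt)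
  rw [zero_smul, add_zero, h2.fderiv] at h3
  exact h3

theorem tendsto_line (p a : V) : Tendsto (fun s : ℝ => p + s • a) (𝓝 0) (𝓝 p) := by
  have : Continuous (fun s : ℝ => p + s • a) := by fun_prop
  simpa using this.tendsto 0

theorem fderiv_fderiv_nonpos_of_isLocalMax_line {f : V → ℝ} {p a : V} (hf : ContDiffAt ℝ 2 f p)
    (hmax : IsLocalMax (fun r : ℝ => f (p + r • a)) 0) :
    fderiv ℝ f p a = 0 ∧ fderiv ℝ (fderiv ℝ f) p a a ≤ 0 := by
  have hd : ∀ᶠ x in 𝓝 p, DifferentiableAt ℝ f x := by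
    filter_upwards [hf.eventually (by simp)] with x hx using hx.differentiableAt (by simp)
  have h1 : deriv (fun r : ℝ => f (p + r • a)) =ᶠ[𝓝 0] fun r => fderiv ℝ f (p + r • a) a := by
    filter_upwards [(tendsto_line p a).eventually hd] with r hr using (hasDerivAt_comp_line hr).deriv
  have hdd : DifferentiableAt ℝ (fderiv ℝ f) (p + (0 : ℝ) • a) := by
    simpa using (hf.fderiv_right (m := 1) (by norm_num)).differentiableAt (by simp)
  have h2 := ((hasDerivAt_comp_line hdd).clm_apply (hasDerivAt_const (0 : ℝ) a)).deriv
  have h3 := hmax.deriv_deriv_nonpos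
    (hasDerivAt_comp_line (r := 0) (by simpa using hd.self_of_nhds)).continuousAt
  constructor
  · simpa [h1.self_of_nhds] using hmax.deriv_eq_zero
  · rw [h1.deriv_eq, h2] at h3
    simpa using h3

theorem ContDiffAt.fderiv_fderiv_apply_eq {f : V → ℝ} {p : V} (hf : ContDiffAt ℝ 2 f p) (e : V) :
    fderiv ℝ (fun x => fderiv ℝ f x e) p = fderiv ℝ (fderiv ℝ f) p e := by
  have hd : DifferentiableAt ℝ (fderiv ℝ f) p :=
    (hf.fderiv_right (m := 1) (by norm_num)).differentiableAt (by simp)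
  ext z
  rw [(hd.hasFDerivAt.clm_apply (hasFDerivAt_const e p)).fderiv]
  simpa using (hf.isSymmSndFDerivAt (by simp)) z e

/-- Symmetry of second derivatives, applied first to `f` and then to its derivative, moves `e` to
the front. This exchange uses the third derivative of the solution. -/
theorem ContDiffAt.fderiv_fderiv_fderiv_apply_eq {f : V → ℝ} {p : V} (hf : ContDiffAt ℝ 3 f p)
    (e z₁ z₂ : V) :
    fderiv ℝ (fderiv ℝ (fun x => fderiv ℝ f x e)) p z₁ z₂ =
      fderiv ℝ (fderiv ℝ (fderiv ℝ f)) p e z₁ z₂ := by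
  have h2 : ContDiffAt ℝ 2 (fderiv ℝ f) p := hf.fderiv_right (by norm_num)
  have h1 : fderiv ℝ (fun x => fderiv ℝ f x e) =ᶠ[𝓝 p] fun x => fderiv ℝ (fderiv ℝ f) x e := by
    filter_upwards [(hf.of_le (by norm_num : (2 : ℕ∞ω) ≤ 3)).eventually (by simp)] with x hx
      using hx.fderiv_fderiv_apply_eq e
  have hd : DifferentiableAt ℝ (fderiv ℝ (fderiv ℝ f)) p :=
    (h2.fderiv_right (m := 1) (by norm_num)).differentiableAt (by simp)
  rw [h1.fderiv_eq, (hd.hasFDerivAt.clm_apply (hasFDerivAt_const e p)).fderiv]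
  simpa using congrArg (fun L => L z₂) ((h2.isSymmSndFDerivAt (by simp)) z₁ e)

/-- Ellipticity: the coefficient matrix `I - p pᵀ / (1 + |p|²)` is positive. With `z = ∑ p k • v k`
and `c = 1 / (1 + |p|²)`, completing the square writes the left side as `∑ K(v k - c p k z, v k - c
p k z) + c² K(z, z)`, where every term is nonpositive. -/
theorem quadratic_trace_nonpos {E : Type*} [AddCommGroup E] [Module ℝ E] {n : ℕ}
    (K : E →ₗ[ℝ] E →ₗ[ℝ] ℝ) (hK : ∀ z, K z z ≤ 0) (v : Fin n → E) (p : Fin n → ℝ) :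
    ∑ i, K (v i) (v i) - (∑ i, ∑ k, p i * p k * K (v i) (v k)) / (1 + ∑ i, p i ^ 2) ≤ 0 := by
  set z := ∑ k, p k • v k with hz
  set P := ∑ i, p i ^ 2 with hP
  have hP0 : 0 ≤ P := Finset.sum_nonneg fun i _ => sq_nonneg _
  have hzz : K z z = ∑ i, ∑ k, p i * p k * K (v i) (v k) := by
    simp [hz, map_sum, LinearMap.sum_apply, Finset.mul_sum, mul_assoc]
    rw [Finset.sum_comm]
    exact Finset.sum_congr rfl fun i _ => Finset.sum_congr rfl fun k _ => by ring
  have hleft : ∑ k, p k * K (v k) z = K z z := by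
    have : K z = ∑ k, p k • K (v k) := by simp [hz]
    rw [this, LinearMap.sum_apply]
    simp
  have hright : ∑ k, p k * K z (v k) = K z z := by
    conv_rhs => arg 2; rw [hz]
    simp
  set c := 1 / (1 + P) with hc
  have hsum : ∑ k, K (v k - (c * p k) • z) (v k - (c * p k) • z)
      = ∑ k, K (v k) (v k) - 2 * c * K z z + c ^ 2 * P * K z z := by
    have : ∀ k, K (v k - (c * p k) • z) (v k - (c * p k) • z)
        = K (v k) (v k) - c * (p k * K (v k) z) - c * (p k * K z (v k))
          + c ^ 2 * K z z * p k ^ 2 := by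
      intro k
      simp only [map_sub, map_smul, LinearMap.sub_apply, LinearMap.smul_apply, smul_eq_mul]
      ring
    simp only [this, Finset.sum_add_distrib, Finset.sum_sub_distrib, ← Finset.mul_sum, hleft,
      hright]
    ring
  have hneg : ∑ k, K (v k - (c * p k) • z) (v k - (c * p k) • z) ≤ 0 :=
    Finset.sum_nonpos fun k _ => hK _
  rw [hsum] at hneg
  rw [← hzz]
  have hid : K z z / (1 + P) = c * K z z := by rw [hc]; ring
  have hcP : c * (1 + P) = 1 := by rw [hc]; field_simp
  have hc0 : 0 < c := by positivity
  have hkey : (2 * c - c ^ 2 * P) - c = c ^ 2 := by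
    have : c * P = 1 - c := by linarith
    rw [pow_two, mul_assoc, this]; ring
  rw [hid]
  nlinarith [mul_nonneg (sq_nonneg c) (neg_nonneg.2 (hK z))]

/-- At a critical point of the differentiated function the first order quantities `p i` are
stationary, so only the second order quantities `q i j` contribute. -/
theorem hasDerivAt_quasilinear {n : ℕ} {p : Fin n → ℝ → ℝ} {q : Fin n → Fin n → ℝ → ℝ}
    {k : Fin n → Fin n → ℝ} (hp : ∀ i, HasDerivAt (p i) 0 0)
    (hq : ∀ i j, HasDerivAt (q i j) (k i j) 0) :
    HasDerivAt (fun s => ∑ i, q i i s -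
        (∑ i, ∑ j, p i s * p j s * q i j s) / (1 + ∑ i, p i s ^ 2))
      (∑ i, k i i - (∑ i, ∑ j, p i 0 * p j 0 * k i j) / (1 + ∑ i, p i 0 ^ 2)) 0 := by
  have h1 : HasDerivAt (fun s => ∑ i, q i i s) (∑ i, k i i) 0 :=
    HasDerivAt.fun_sum fun i _ => hq i i
  have h2 : HasDerivAt (fun s => ∑ i, ∑ j, p i s * p j s * q i j s)
      (∑ i, ∑ j, p i 0 * p j 0 * k i j) 0 := by
    refine HasDerivAt.fun_sum fun i _ => HasDerivAt.fun_sum fun j _ => ?_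
    simpa using ((hp i).fun_mul (hp j)).fun_mul (hq i j)
  have h3 : HasDerivAt (fun s => 1 + ∑ i, p i s ^ 2) 0 0 := by
    have : HasDerivAt (fun s => ∑ i, p i s ^ 2) (∑ i : Fin n, (0 : ℝ)) 0 :=
      HasDerivAt.fun_sum fun i _ => by simpa using (hp i).fun_pow 2
    simpa using this.const_add 1
  have hne : 1 + ∑ i, p i 0 ^ 2 ≠ 0 :=
    (add_pos_of_pos_of_nonneg one_pos (Finset.sum_nonneg fun i _ => sq_nonneg _)).ne'
  refine (h1.fun_sub (h2.fun_div h3 hne)).congr_deriv ?_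
  rw [mul_zero, sub_zero, pow_two, mul_div_mul_right _ _ hne]

/-- If the derivative of `F` in the direction `e` has a maximum along all lines in the directions
`ι z`, and if on the line through `p` with direction `e` the derivative of `F` in the direction `τ`
is given by the quasilinear operator of mean curvature type, then the mixed derivative of `F` in
the directions `τ` and `e` is nonpositive. -/
theorem fderiv_fderiv_apply_nonpos_of_quasilinear {E : Type*} [NormedAddCommGroup E]
    [NormedSpace ℝ E] {F : V → ℝ} {p e τ : V} (hF : ContDiffAt ℝ 3 F p) (ι : E →L[ℝ] V)
    (hmax : ∀ z, IsLocalMax (fun r : ℝ => fderiv ℝ F (p + r • ι z) e) 0) {n : ℕ}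
    (v : Fin n → E) (c : Fin n → Fin n → E) {P : Fin n → ℝ → ℝ} {q : Fin n → Fin n → ℝ → ℝ}
    (hP : ∀ i, ∀ᶠ s in 𝓝 (0 : ℝ), P i s = fderiv ℝ F (p + s • e) (ι (v i)))
    (hq : ∀ i j, ∀ᶠ s in 𝓝 (0 : ℝ), q i j s =
      fderiv ℝ (fderiv ℝ F) (p + s • e) (ι (v i)) (ι (v j)) + fderiv ℝ F (p + s • e) (ι (c i j)))
    (heq : ∀ᶠ s in 𝓝 (0 : ℝ), fderiv ℝ F (p + s • e) τ = ∑ i, q i i s -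
      (∑ i, ∑ j, P i s * P j s * q i j s) / (1 + ∑ i, P i s ^ 2)) :
    fderiv ℝ (fun x => fderiv ℝ F x e) p τ ≤ 0 := by
  have hF2 : ContDiffAt ℝ 2 F p := hF.of_le (by norm_num)
  have hG : ContDiffAt ℝ 2 (fun x => fderiv ℝ F x e) p :=
    (hF.fderiv_right (m := 2) (by norm_num)).clm_apply contDiffAt_const
  have hd1 : DifferentiableAt ℝ (fderiv ℝ F) (p + (0 : ℝ) • e) := by
    simpa using (hF.fderiv_right (m := 2) (by norm_num)).differentiableAt (by simp)
  have hd2 : DifferentiableAt ℝ (fderiv ℝ (fderiv ℝ F)) (p + (0 : ℝ) • e) := by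
    simpa using ((hF.fderiv_right (m := 2) (by norm_num)).fderiv_right
      (m := 1) (by norm_num)).differentiableAt (by simp)
  have hline1 : ∀ a, HasDerivAt (fun s : ℝ => fderiv ℝ F (p + s • e) a)
      (fderiv ℝ (fun x => fderiv ℝ F x e) p a) 0 := by
    intro a
    rw [hF2.fderiv_fderiv_apply_eq e]
    simpa using (hasDerivAt_comp_line hd1).clm_apply (hasDerivAt_const (0 : ℝ) a)
  have hline2 : ∀ a b, HasDerivAt (fun s : ℝ => fderiv ℝ (fderiv ℝ F) (p + s • e) a b)
      (fderiv ℝ (fderiv ℝ (fun x => fderiv ℝ F x e)) p a b) 0 := by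
    intro a b
    rw [hF.fderiv_fderiv_fderiv_apply_eq]
    exact hasDerivAt_bilin_comp_line (by simpa using hd2) a b
  have hext := fun z => fderiv_fderiv_nonpos_of_isLocalMax_line hG (hmax z)
  have hP' : ∀ i, HasDerivAt (P i) 0 0 := by
    intro i
    have := hline1 (ι (v i))
    rw [(hext (v i)).1] at this
    exact this.congr_of_eventuallyEq (hP i)
  have hq' : ∀ i j, HasDerivAt (q i j)
      (fderiv ℝ (fderiv ℝ (fun x => fderiv ℝ F x e)) p (ι (v i)) (ι (v j))) 0 := by
    intro i j
    have := (hline2 (ι (v i)) (ι (v j))).add (hline1 (ι (c i j)))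
    rw [(hext (c i j)).1, add_zero] at this
    exact this.congr_of_eventuallyEq (hq i j)
  -- Differentiating both sides of `heq` at `s = 0` gives the mixed derivative on one side and, on
  -- the other, the trace of a Hessian that is nonpositive on the range of `ι`.
  have hB := (hasDerivAt_quasilinear hP' hq').congr_of_eventuallyEq heq
  rw [(hline1 τ).unique hB]
  let K : E →ₗ[ℝ] E →ₗ[ℝ] ℝ := LinearMap.mk₂ ℝ
    (fun a b => fderiv ℝ (fderiv ℝ (fun x => fderiv ℝ F x e)) p (ι a) (ι b))
    (by simp) (by simp) (by simp) (by simp)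
  exact quadratic_trace_nonpos K (fun z => (hext z).2) v (fun i => P i 0)

end Calculus

/-! ### Left invariant derivatives in the chart at the identity -/

namespace MeanCurvatureFlow

variable {E G : Type*} [NormedAddCommGroup E] [NormedSpace ℝ E]
  [TopologicalSpace G] [ChartedSpace E G] [Group G]

theorem natCast_le_infty (k : ℕ) : (k : ℕ∞ω) ≤ (∞ : ℕ∞ω) := by
  exact_mod_cast (le_top : (k : ℕ∞) ≤ ⊤)

/-- The chart at the identity, with values in the model vector space. -/
noncomputable abbrev idChart (E G : Type*) [NormedAddCommGroup E] [NormedSpace ℝ E]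
    [TopologicalSpace G] [ChartedSpace E G] [Group G] : PartialEquiv G E :=
  extChartAt 𝓘(ℝ, E) (1 : G)

theorem leftDeriv_one (v : GroupLieAlgebra 𝓘(ℝ, E) G) (f : G → ℝ) :
    leftDeriv v f 1 = mfderiv 𝓘(ℝ, E) 𝓘(ℝ, ℝ) f 1 v := by
  have : mulInvariantVectorField v (1 : G) = v := by
    unfold mulInvariantVectorField
    have h : (fun y : G => 1 * y) = id := by funext y; simp
    rw [h, mfderiv_id]
    rfl
  rw [leftDeriv, this]

theorem idChart_symm_one : (idChart E G).symm (idChart E G 1) = 1 :=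
  extChartAt_to_inv (I := 𝓘(ℝ, E)) (1 : G)

theorem idChart_one_mem_target : idChart E G 1 ∈ (idChart E G).target :=
  mem_extChartAt_target (I := 𝓘(ℝ, E)) (1 : G)

theorem eventually_mem_target : ∀ᶠ y in 𝓝 (idChart E G 1), y ∈ (idChart E G).target :=
  (isOpen_extChartAt_target (I := 𝓘(ℝ, E)) (1 : G)).mem_nhds idChart_one_mem_target

theorem leftDeriv_one_eq_fderiv (v : GroupLieAlgebra 𝓘(ℝ, E) G) {f : G → ℝ}
    (hf : MDifferentiableAt 𝓘(ℝ, E) 𝓘(ℝ, ℝ) f 1) :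
    leftDeriv v f 1 = fderiv ℝ (fun z => f ((idChart E G).symm z)) (idChart E G 1) v := by
  have h : fderivWithin ℝ (writtenInExtChartAt 𝓘(ℝ, E) 𝓘(ℝ, ℝ) 1 f) (range 𝓘(ℝ, E))
      (idChart E G 1) = fderiv ℝ (fun z => f ((idChart E G).symm z)) (idChart E G 1) := by
    rw [ModelWithCorners.Boundaryless.range_eq_univ, fderivWithin_univ]
    rfl
  rw [leftDeriv_one, ← h, hf.mfderiv]
  rfl

/-- The multiplication in the chart at the identity. -/
noncomputable def chartMul (E G : Type*) [NormedAddCommGroup E] [NormedSpace ℝ E]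
    [TopologicalSpace G] [ChartedSpace E G] [Group G] (y z : E) : E :=
  idChart E G ((idChart E G).symm y * (idChart E G).symm z)

/-- The left invariant vector field generated by `v` in the chart at the identity. -/
noncomputable def chartField (v : GroupLieAlgebra 𝓘(ℝ, E) G) (y : E) : E :=
  fderiv ℝ (chartMul E G y) (idChart E G 1) v

theorem chartMul_one {y : E} (hy : y ∈ (idChart E G).target) :
    chartMul E G y (idChart E G 1) = y := by
  rw [chartMul, idChart_symm_one, mul_one, (idChart E G).right_inv hy]

theorem chartField_one (v : GroupLieAlgebra 𝓘(ℝ, E) G) : chartField v (idChart E G 1) = v := by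
  have : chartMul E G (idChart E G 1) =ᶠ[𝓝 (idChart E G 1)] id := by
    filter_upwards [eventually_mem_target (E := E) (G := G)] with z hz
    simp only [chartMul, idChart_symm_one, one_mul, id]
    exact (idChart E G).right_inv hz
  rw [chartField, this.fderiv_eq, fderiv_id]
  rfl

variable [LieGroup 𝓘(ℝ, E) ∞ G]

theorem mdifferentiableAt_mul_left (a x : G) :
    MDifferentiableAt 𝓘(ℝ, E) 𝓘(ℝ, E) (a * ·) x :=
  (contMDiff_mul_left (I := 𝓘(ℝ, E)) (n := ∞) (a := a)).mdifferentiableAt (by simp)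

theorem mulInvariantVectorField_mul (v : GroupLieAlgebra 𝓘(ℝ, E) G) (a x : G) :
    mulInvariantVectorField v (a * x) =
      mfderiv 𝓘(ℝ, E) 𝓘(ℝ, E) (a * ·) x (mulInvariantVectorField v x) := by
  have hcomp : (fun y : G => a * x * y) = (a * ·) ∘ (x * ·) := by
    funext y; simp [mul_assoc]
  have h := mfderiv_comp_apply_of_eq (x := (1 : G)) (mdifferentiableAt_mul_left (E := E) a x)
    (mdifferentiableAt_mul_left x 1) (mul_one x) v
  rw [← hcomp] at h
  exact h

/-- The left invariance on which everything rests. It needs no regularity: translation preserves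
nondifferentiability, and then both sides are `0`. It can therefore be iterated freely. -/
theorem leftDeriv_comp_mul_left (v : GroupLieAlgebra 𝓘(ℝ, E) G) (f : G → ℝ) (a x : G) :
    leftDeriv v (fun y => f (a * y)) x = leftDeriv v f (a * x) := by
  by_cases hf : MDifferentiableAt 𝓘(ℝ, E) 𝓘(ℝ, ℝ) f (a * x)
  · unfold leftDeriv
    rw [mulInvariantVectorField_mul]
    have := mfderiv_comp (I' := 𝓘(ℝ, E)) (I'' := 𝓘(ℝ, ℝ)) x hf (mdifferentiableAt_mul_left a x)
    exact congrArg (fun L => L (mulInvariantVectorField v x)) this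
  · have hf' : ¬ MDifferentiableAt 𝓘(ℝ, E) 𝓘(ℝ, ℝ) (fun y => f (a * y)) x := by
      intro h
      apply hf
      have h1 : MDifferentiableAt 𝓘(ℝ, E) 𝓘(ℝ, ℝ) (fun y => f (a * y)) (a⁻¹ * (a * x)) := by
        simpa using h
      simpa [Function.comp_def] using
        MDifferentiableAt.comp (a * x) h1 (mdifferentiableAt_mul_left a⁻¹ (a * x))
    unfold leftDeriv
    rw [mfderiv_zero_of_not_mdifferentiableAt hf, mfderiv_zero_of_not_mdifferentiableAt hf']
    rfl

theorem contMDiffAt_idChart_symm {y : E} (hy : y ∈ (idChart E G).target) :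
    ContMDiffAt 𝓘(ℝ, E) 𝓘(ℝ, E) ∞ (idChart E G).symm y :=
  (contMDiffOn_extChartAt_symm (I := 𝓘(ℝ, E)) (n := ∞) (1 : G)).contMDiffAt
    ((isOpen_extChartAt_target (I := 𝓘(ℝ, E)) (1 : G)).mem_nhds hy)

theorem contMDiffAt_idChart {x : G} (hx : x ∈ (idChart E G).source) :
    ContMDiffAt 𝓘(ℝ, E) 𝓘(ℝ, E) ∞ (idChart E G) x :=
  contMDiffAt_extChartAt' (by simpa using hx)

theorem contDiffAt_comp_idChart_symm {f : G → ℝ} {k : ℕ∞ω} (hk : k ≤ (∞ : ℕ∞ω)) {y : E}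
    (hy : y ∈ (idChart E G).target) (hf : ContMDiffAt 𝓘(ℝ, E) 𝓘(ℝ, ℝ) k f ((idChart E G).symm y)) :
    ContDiffAt ℝ k (fun z => f ((idChart E G).symm z)) y :=
  (hf.comp y ((contMDiffAt_idChart_symm hy).of_le hk)).contDiffAt

theorem contMDiffAt_one_of_contDiffAt {f : G → ℝ} {k : ℕ∞ω} (hk : k ≤ (∞ : ℕ∞ω))
    (hf : ContDiffAt ℝ k (fun z => f ((idChart E G).symm z)) (idChart E G 1)) :
    ContMDiffAt 𝓘(ℝ, E) 𝓘(ℝ, ℝ) k f 1 := by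
  have h1 := hf.contMDiffAt.comp (1 : G)
    ((contMDiffAt_idChart (mem_extChartAt_source (I := 𝓘(ℝ, E)) (1 : G))).of_le hk)
  refine h1.congr_of_eventuallyEq ?_
  filter_upwards [extChartAt_source_mem_nhds (I := 𝓘(ℝ, E)) (1 : G)] with x hx
  simp only [Function.comp]
  rw [(idChart E G).left_inv hx]

theorem leftDeriv_eq_fderiv (v : GroupLieAlgebra 𝓘(ℝ, E) G) {f : G → ℝ} {x : G}
    (hf : MDifferentiableAt 𝓘(ℝ, E) 𝓘(ℝ, ℝ) f x) :
    leftDeriv v f x = fderiv ℝ (fun z => f (x * (idChart E G).symm z)) (idChart E G 1) v := by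
  have h1 : leftDeriv v f x = leftDeriv v (fun y => f (x * y)) 1 := by
    rw [leftDeriv_comp_mul_left, mul_one]
  have hf' : MDifferentiableAt 𝓘(ℝ, E) 𝓘(ℝ, ℝ) f (x * 1) := by rwa [mul_one]
  rw [h1, leftDeriv_one_eq_fderiv]
  exact hf'.comp (1 : G) (mdifferentiableAt_mul_left x 1)

theorem contDiffAt_chartMul {y : E} (hy : y ∈ (idChart E G).target) :
    ContDiffAt ℝ ∞ (fun p : E × E => chartMul E G p.1 p.2) (y, idChart E G 1) := by
  have h1 : ContMDiffAt 𝓘(ℝ, E × E) 𝓘(ℝ, E) ∞ (fun p : E × E => (idChart E G).symm p.1)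
      (y, idChart E G 1) :=
    ContMDiffAt.comp (I' := 𝓘(ℝ, E)) _ (contMDiffAt_idChart_symm hy) contDiffAt_fst.contMDiffAt
  have h2 : ContMDiffAt 𝓘(ℝ, E × E) 𝓘(ℝ, E) ∞ (fun p : E × E => (idChart E G).symm p.2)
      (y, idChart E G 1) :=
    ContMDiffAt.comp (I' := 𝓘(ℝ, E)) _ (contMDiffAt_idChart_symm idChart_one_mem_target)
      contDiffAt_snd.contMDiffAt
  refine ContMDiffAt.contDiffAt (ContMDiffAt.comp (I' := 𝓘(ℝ, E)) _ (contMDiffAt_idChart ?_)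
    (h1.mul h2))
  simp only [idChart_symm_one, mul_one]
  exact (idChart E G).map_target hy

theorem contDiffAt_chartField (v : GroupLieAlgebra 𝓘(ℝ, E) G) :
    ContDiffAt ℝ ∞ (chartField v) (idChart E G 1) := by
  have h := ContDiffAt.fderiv (f := chartMul E G) (g := fun _ => idChart E G 1) (m := ∞)
    (x₀ := idChart E G 1) (contDiffAt_chartMul idChart_one_mem_target) contDiffAt_const (by simp)
  exact h.clm_apply contDiffAt_const

/-- Near the identity, `z ↦ f (κ⁻¹ y * κ⁻¹ z)` is `f ∘ κ⁻¹` composed with `chartMul E G y`, so this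
is the chain rule. -/
theorem leftDeriv_idChart_symm (v : GroupLieAlgebra 𝓘(ℝ, E) G) {f : G → ℝ} {y : E}
    (hy : y ∈ (idChart E G).target)
    (hf : ContMDiffAt 𝓘(ℝ, E) 𝓘(ℝ, ℝ) 1 f ((idChart E G).symm y)) :
    leftDeriv v f ((idChart E G).symm y) =
      fderiv ℝ (fun z => f ((idChart E G).symm z)) y (chartField v y) := by
  rw [leftDeriv_eq_fderiv v (hf.mdifferentiableAt (by simp))]
  have hm : DifferentiableAt ℝ (chartMul E G y) (idChart E G 1) :=
    ((contDiffAt_chartMul hy).differentiableAt (by simp)).comp (idChart E G 1)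
      (f := fun z => (y, z)) (by fun_prop)
  have hf' : DifferentiableAt ℝ (fun z => f ((idChart E G).symm z))
      (chartMul E G y (idChart E G 1)) := by
    rw [chartMul_one hy]
    exact (contDiffAt_comp_idChart_symm (natCast_le_infty 1) hy hf).differentiableAt (by simp)
  have hev : (fun z => f ((idChart E G).symm y * (idChart E G).symm z)) =ᶠ[𝓝 (idChart E G 1)]
      (fun z => f ((idChart E G).symm z)) ∘ chartMul E G y := by
    have hc : ContinuousAt (fun z => (idChart E G).symm y * (idChart E G).symm z)
        (idChart E G 1) :=
      ((mdifferentiableAt_mul_left (E := E) ((idChart E G).symm y) _).continuousAt).comp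
        (contMDiffAt_idChart_symm idChart_one_mem_target).continuousAt
    have hmem : (idChart E G).source ∈
        𝓝 ((idChart E G).symm y * (idChart E G).symm (idChart E G 1)) := by
      rw [idChart_symm_one, mul_one]
      exact (isOpen_extChartAt_source (I := 𝓘(ℝ, E)) (1 : G)).mem_nhds
        ((idChart E G).map_target hy)
    filter_upwards [hc hmem] with z hz
    simp only [Function.comp, chartMul]
    rw [(idChart E G).left_inv hz]
  rw [hev.fderiv_eq, fderiv_comp _ hf' hm, chartMul_one hy]
  rfl

theorem leftDeriv_comp_idChart_symm_eventuallyEq (v : GroupLieAlgebra 𝓘(ℝ, E) G) {f : G → ℝ}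
    {k : ℕ∞ω} (hk : k ≠ 0) (hf : ContMDiffAt 𝓘(ℝ, E) 𝓘(ℝ, ℝ) k f 1) :
    (fun y => leftDeriv v f ((idChart E G).symm y)) =ᶠ[𝓝 (idChart E G 1)]
      fun y => fderiv ℝ (fun z => f ((idChart E G).symm z)) y (chartField v y) := by
  have hf1 : ContMDiffAt 𝓘(ℝ, E) 𝓘(ℝ, ℝ) 1 f 1 := hf.of_le (ENat.one_le_iff_ne_zero_withTop.2 hk)
  have hev := (contMDiffAt_iff_contMDiffAt_nhds (by simp)).1 hf1
  have hc : Tendsto (idChart E G).symm (𝓝 (idChart E G 1)) (𝓝 1) := by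
    have := (contMDiffAt_idChart_symm (E := E) (G := G) idChart_one_mem_target).continuousAt
    rwa [ContinuousAt, idChart_symm_one] at this
  filter_upwards [eventually_mem_target (E := E) (G := G), hc.eventually hev] with y hy hfy
  exact leftDeriv_idChart_symm v hy hfy

theorem contMDiffAt_comp_mul_left {f : G → ℝ} {x : G} {k : ℕ∞ω} (hk : k ≤ (∞ : ℕ∞ω)) (a : G)
    (hf : ContMDiffAt 𝓘(ℝ, E) 𝓘(ℝ, ℝ) k f (a * x)) :
    ContMDiffAt 𝓘(ℝ, E) 𝓘(ℝ, ℝ) k (fun y => f (a * y)) x :=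
  hf.comp x ((contMDiff_mul_left (I := 𝓘(ℝ, E)) (n := ∞) (a := a)).contMDiffAt.of_le hk)

/-- Left translation reduces to `x = 1`, where the derivative is that of `f ∘ κ⁻¹` applied to a
smooth field, at the cost of one order. -/
theorem contMDiffAt_leftDeriv (v : GroupLieAlgebra 𝓘(ℝ, E) G) {f : G → ℝ} {x : G}
    {k : ℕ∞} (hf : ContMDiffAt 𝓘(ℝ, E) 𝓘(ℝ, ℝ) (k + 1 : ℕ∞) f x) :
    ContMDiffAt 𝓘(ℝ, E) 𝓘(ℝ, ℝ) k (leftDeriv v f) x := by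
  have hle : ∀ l : ℕ∞, (l : ℕ∞ω) ≤ (∞ : ℕ∞ω) := fun l => by exact_mod_cast le_top
  have key : ∀ {g : G → ℝ}, ContMDiffAt 𝓘(ℝ, E) 𝓘(ℝ, ℝ) (k + 1 : ℕ∞) g 1 →
      ContMDiffAt 𝓘(ℝ, E) 𝓘(ℝ, ℝ) k (leftDeriv v g) 1 := by
    intro g hg
    refine contMDiffAt_one_of_contDiffAt (hle k) ?_
    refine ContDiffAt.congr_of_eventuallyEq ?_
      (leftDeriv_comp_idChart_symm_eventuallyEq v (by simp) hg)
    have hg' : ContDiffAt ℝ (k + 1 : ℕ∞) (fun z => g ((idChart E G).symm z)) (idChart E G 1) :=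
      contDiffAt_comp_idChart_symm (hle _) idChart_one_mem_target (by rwa [idChart_symm_one])
    exact (hg'.fderiv_right (m := k) (by simp)).clm_apply
      ((contDiffAt_chartField v).of_le (hle k))
  have h1 := key (contMDiffAt_comp_mul_left (x := 1) (hle _) x (by rwa [mul_one]))
  have h2 := contMDiffAt_comp_mul_left (x := x) (hle k) x⁻¹ (by rwa [inv_mul_cancel])
  refine h2.congr_of_eventuallyEq (Eventually.of_forall fun y => ?_)
  simp [leftDeriv_comp_mul_left]

/-- The first order correction involves the vector `D(chartField w) v`, which depends on `v` and `w`
only. After a left translation to the identity it is the same at every point of the group. -/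
theorem leftDeriv_leftDeriv_one (v w : GroupLieAlgebra 𝓘(ℝ, E) G) {f : G → ℝ}
    (hf : ContMDiffAt 𝓘(ℝ, E) 𝓘(ℝ, ℝ) 2 f 1) :
    leftDeriv v (leftDeriv w f) 1 =
      fderiv ℝ (fderiv ℝ (fun z => f ((idChart E G).symm z))) (idChart E G 1) v w +
      fderiv ℝ (fun z => f ((idChart E G).symm z)) (idChart E G 1)
        (fderiv ℝ (chartField w) (idChart E G 1) v) := by
  have hd : MDifferentiableAt 𝓘(ℝ, E) 𝓘(ℝ, ℝ) (leftDeriv w f) 1 :=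
    (contMDiffAt_leftDeriv w (k := 1) hf).mdifferentiableAt (by simp)
  have hf' : ContDiffAt ℝ 2 (fun z => f ((idChart E G).symm z)) (idChart E G 1) :=
    contDiffAt_comp_idChart_symm (natCast_le_infty 2) idChart_one_mem_target
      (by rwa [idChart_symm_one])
  have h1 : DifferentiableAt ℝ (fderiv ℝ (fun z => f ((idChart E G).symm z))) (idChart E G 1) :=
    (hf'.fderiv_right (m := 1) (by norm_num)).differentiableAt (by simp)
  have h2 : DifferentiableAt ℝ (chartField w) (idChart E G 1) :=
    (contDiffAt_chartField w).differentiableAt (by simp)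
  rw [leftDeriv_one_eq_fderiv v hd,
    (leftDeriv_comp_idChart_symm_eventuallyEq w (by simp) hf).fderiv_eq,
    (h1.hasFDerivAt.clm_apply h2.hasFDerivAt).fderiv, chartField_one]
  exact add_comm _ _

end MeanCurvatureFlow

/-! ### Nondivergence form of the equation and curves of left translations -/

namespace MeanCurvatureFlow

theorem hasDerivAt_div_sqrt {n : ℕ} {p : Fin n → ℝ → ℝ} {d : Fin n → ℝ}
    (hp : ∀ k, HasDerivAt (p k) (d k) 0) (i : Fin n) :
    HasDerivAt (fun r => p i r / Real.sqrt (1 + ∑ k, p k r ^ 2))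
      ((d i - p i 0 * (∑ k, p k 0 * d k) / (1 + ∑ k, p k 0 ^ 2)) /
        Real.sqrt (1 + ∑ k, p k 0 ^ 2)) 0 := by
  have hpos : 0 < 1 + ∑ k, p k 0 ^ 2 :=
    add_pos_of_pos_of_nonneg one_pos (Finset.sum_nonneg fun i _ => sq_nonneg _)
  have h1 : HasDerivAt (fun r => 1 + ∑ k, p k r ^ 2) (2 * ∑ k, p k 0 * d k) 0 := by
    have : HasDerivAt (fun r => ∑ k, p k r ^ 2) (∑ k, 2 * (p k 0 * d k)) 0 :=
      HasDerivAt.fun_sum fun k _ => by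
        simpa [mul_assoc] using (hp k).fun_pow 2
    rw [Finset.mul_sum]
    exact this.const_add 1
  have hs : Real.sqrt (1 + ∑ k, p k 0 ^ 2) ≠ 0 := (Real.sqrt_pos.2 hpos).ne'
  refine ((hp i).fun_div (h1.sqrt hpos.ne') hs).congr_deriv ?_
  have hsq := Real.sq_sqrt hpos.le
  generalize Real.sqrt (1 + ∑ k, p k 0 ^ 2) = w at *
  rw [← hsq]
  field_simp

variable {E G : Type*} [NormedAddCommGroup E] [NormedSpace ℝ E]
  [TopologicalSpace G] [ChartedSpace E G] [Group G]

/-- The point with coordinates `κ 1 + z`, where `κ` is the chart at the identity. -/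
noncomputable def chartPoint (G : Type*) {E : Type*} [NormedAddCommGroup E] [NormedSpace ℝ E]
    [TopologicalSpace G] [ChartedSpace E G] [Group G] (z : E) : G :=
  (idChart E G).symm (idChart E G 1 + z)

/-- The curve through `1` with velocity `w` that is straight in the chart at the identity. -/
noncomputable def chartCurve (w : GroupLieAlgebra 𝓘(ℝ, E) G) (s : ℝ) : G :=
  chartPoint (E := E) G (s • w)

theorem chartPoint_zero : chartPoint G (0 : E) = 1 := by
  rw [chartPoint, add_zero, idChart_symm_one]

theorem chartCurve_zero (w : GroupLieAlgebra 𝓘(ℝ, E) G) : chartCurve w 0 = 1 := by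
  rw [chartCurve, zero_smul]
  exact chartPoint_zero

/-- The curve `chartCurve w`, conjugated by `g`. -/
noncomputable def conjCurve (g : G) (w : GroupLieAlgebra 𝓘(ℝ, E) G) (s : ℝ) : G :=
  g * chartCurve w s * g⁻¹

theorem conjCurve_zero (g : G) (w : GroupLieAlgebra 𝓘(ℝ, E) G) : conjCurve g w 0 = 1 := by
  rw [conjCurve, chartCurve_zero, mul_one, mul_inv_cancel]

variable [LieGroup 𝓘(ℝ, E) ∞ G]

theorem hasDerivAt_comp_chartCurve {f : G → ℝ} (hf : ContMDiffAt 𝓘(ℝ, E) 𝓘(ℝ, ℝ) 1 f 1)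
    (w : GroupLieAlgebra 𝓘(ℝ, E) G) :
    HasDerivAt (fun r : ℝ => f (chartCurve w r)) (leftDeriv w f 1) 0 := by
  rw [← idChart_symm_one (E := E)] at hf
  have h2 := (contDiffAt_comp_idChart_symm (natCast_le_infty 1) idChart_one_mem_target
    hf).differentiableAt (by simp)
  rw [idChart_symm_one] at hf
  rw [leftDeriv_one_eq_fderiv _ (hf.mdifferentiableAt (by simp))]
  have h3 : ∀ z : E, HasDerivAt (fun r : ℝ => f ((idChart E G).symm (idChart E G 1 + r • z)))
      (fderiv ℝ (fun z => f ((idChart E G).symm z)) (idChart E G 1) z) 0 := by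
    intro z
    have := hasDerivAt_comp_line (p := idChart E G 1) (a := z) (r := 0)
      (f := fun z => f ((idChart E G).symm z)) (by rwa [zero_smul, add_zero])
    rwa [zero_smul, add_zero] at this
  exact h3 w

theorem hasDerivAt_leftDeriv (v : GroupLieAlgebra 𝓘(ℝ, E) G) {f : G → ℝ} {x : G}
    (hf : ContMDiffAt 𝓘(ℝ, E) 𝓘(ℝ, ℝ) 1 f x) :
    HasDerivAt (fun r : ℝ => f (x * chartCurve v r)) (leftDeriv v f x) 0 := by
  have h := hasDerivAt_comp_chartCurve
    (contMDiffAt_comp_mul_left (x := 1) (natCast_le_infty 1) x (by rwa [mul_one])) v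
  rw [leftDeriv_comp_mul_left, mul_one] at h
  exact h

variable {n m : ℕ}

/-- Each divergence term is expanded by the quotient rule along a curve with velocity `X_i^ε`.
Multiplication by `W_ε` cancels the remaining square root and leaves the matrix `I - p pᵀ / (1 +
|p|²)`. -/
theorem meanCurvature_mul_areaElement (F : StepTwoFrame E G n m) (ε : ℝ) {f : G → ℝ} {x : G}
    (hf : ContMDiffAt 𝓘(ℝ, E) 𝓘(ℝ, ℝ) 2 f x) :
    meanCurvature F ε f x * areaElement F ε f x =
      ∑ i, frameDeriv F ε i (frameDeriv F ε i f) x -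
      (∑ i, ∑ j, frameDeriv F ε i f x * frameDeriv F ε j f x *
        frameDeriv F ε i (frameDeriv F ε j f) x) / (1 + ∑ i, frameDeriv F ε i f x ^ 2) := by
  have hp : ∀ k, ContMDiffAt 𝓘(ℝ, E) 𝓘(ℝ, ℝ) 1 (frameDeriv F ε k f) x := fun k =>
    contMDiffAt_leftDeriv _ (k := 1) hf
  have hpos : ∀ a : Fin n → ℝ, 0 < 1 + ∑ k, a k ^ 2 := fun a =>
    add_pos_of_pos_of_nonneg one_pos (Finset.sum_nonneg fun i _ => sq_nonneg _)
  have hQ : ∀ i : Fin n, ContDiff ℝ 1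
      (fun a : Fin n → ℝ => a i / Real.sqrt (1 + ∑ k, a k ^ 2)) := by
    intro i
    refine ContDiff.div (by fun_prop) (ContDiff.sqrt (by fun_prop) fun a => (hpos a).ne') fun a =>
      (Real.sqrt_pos.2 (hpos a)).ne'
  have hq : ∀ i, ContMDiffAt 𝓘(ℝ, E) 𝓘(ℝ, ℝ) 1
      (fun y => frameDeriv F ε i f y / areaElement F ε f y) x := fun i =>
    (hQ i).contMDiff.contMDiffAt.comp x (contMDiffAt_pi_space.2 hp)
  have hd : ∀ i, frameDeriv F ε i (fun y => frameDeriv F ε i f y / areaElement F ε f y) x =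
      (frameDeriv F ε i (frameDeriv F ε i f) x - frameDeriv F ε i f x *
        (∑ k, frameDeriv F ε k f x * frameDeriv F ε i (frameDeriv F ε k f) x) /
        (1 + ∑ k, frameDeriv F ε k f x ^ 2)) / areaElement F ε f x := by
    intro i
    have h1 := hasDerivAt_leftDeriv ((if i.val < m then (1 : ℝ) else ε) • F.X i) (hq i)
    have h2 := hasDerivAt_div_sqrt (fun k => hasDerivAt_leftDeriv
      ((if i.val < m then (1 : ℝ) else ε) • F.X i) (hp k)) i
    simp only [chartCurve_zero, mul_one] at h2
    exact h1.unique h2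
  have hW : areaElement F ε f x ≠ 0 := (Real.sqrt_pos.2 (hpos _)).ne'
  rw [meanCurvature, Finset.sum_mul]
  simp only [hd, div_mul_cancel₀ _ hW]
  rw [Finset.sum_sub_distrib, Finset.sum_div]
  simp only [Finset.mul_sum, mul_assoc]

theorem contMDiffAt_chartPoint : ContMDiffAt 𝓘(ℝ, E) 𝓘(ℝ, E) ∞ (chartPoint G) (0 : E) := by
  have h1 : ContMDiffAt 𝓘(ℝ, E) 𝓘(ℝ, E) ∞ (fun z : E => idChart E G 1 + z) 0 :=
    ContDiff.contMDiff (by fun_prop) |>.contMDiffAt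
  refine ContMDiffAt.comp (I' := 𝓘(ℝ, E)) (0 : E) (contMDiffAt_idChart_symm ?_) h1
  rw [add_zero]
  exact idChart_one_mem_target

theorem contMDiffAt_chartCurve (w : GroupLieAlgebra 𝓘(ℝ, E) G) :
    ContMDiffAt 𝓘(ℝ, ℝ) 𝓘(ℝ, E) ∞ (chartCurve w) 0 := by
  have h : ∀ z : E, ContMDiffAt 𝓘(ℝ, ℝ) 𝓘(ℝ, E) ∞ (fun s : ℝ => chartPoint G (s • z)) 0 := by
    intro z
    have h1 : ContMDiffAt 𝓘(ℝ, ℝ) 𝓘(ℝ, E) ∞ (fun s : ℝ => s • z) 0 :=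
      ContDiff.contMDiff (by fun_prop) |>.contMDiffAt
    exact ContMDiffAt.comp_of_eq (I' := 𝓘(ℝ, E)) (g := chartPoint G) (f := fun s : ℝ => s • z)
      contMDiffAt_chartPoint h1 (zero_smul ℝ z)
  exact h w

theorem contMDiffAt_conjCurve (g : G) (w : GroupLieAlgebra 𝓘(ℝ, E) G) :
    ContMDiffAt 𝓘(ℝ, ℝ) 𝓘(ℝ, E) ∞ (conjCurve g w) 0 :=
  ((contMDiffAt_const (c := g)).mul (contMDiffAt_chartCurve w)).mul (contMDiffAt_const (c := g⁻¹))

/-- The function `(s, y, t) ↦ u (η s * x * κ⁻¹ y, t)`, where `η` is `conjCurve g w` and `κ` is the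
chart at the identity. -/
noncomputable def flowChart (u : G × ℝ → ℝ) (g : G) (w : GroupLieAlgebra 𝓘(ℝ, E) G) (x : G) (q : ℝ × E × ℝ) : ℝ :=
  u (conjCurve g w q.1 * x * (idChart E G).symm q.2.1, q.2.2)

theorem contDiffAt_flowChart {u : G × ℝ → ℝ} {x : G} {t : ℝ} {k : ℕ}
    (hu : ContMDiffAt (𝓘(ℝ, E).prod 𝓘(ℝ, ℝ)) 𝓘(ℝ, ℝ) k u (x, t)) (g : G) (w : GroupLieAlgebra 𝓘(ℝ, E) G) :
    ContDiffAt ℝ k (flowChart u g w x) (0, idChart E G 1, t) := by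
  have h1 : ContMDiffAt 𝓘(ℝ, ℝ × E × ℝ) 𝓘(ℝ, E) ∞
      (fun q : ℝ × E × ℝ => conjCurve g w q.1) (0, idChart E G 1, t) :=
    ContMDiffAt.comp (I' := 𝓘(ℝ, ℝ)) (g := conjCurve g w) (0, idChart E G 1, t)
      (contMDiffAt_conjCurve g w) contDiffAt_fst.contMDiffAt
  have h2 : ContMDiffAt 𝓘(ℝ, ℝ × E × ℝ) 𝓘(ℝ, E) ∞
      (fun q : ℝ × E × ℝ => (idChart E G).symm q.2.1) (0, idChart E G 1, t) :=
    ContMDiffAt.comp (I' := 𝓘(ℝ, E)) _ (contMDiffAt_idChart_symm idChart_one_mem_target)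
      (ContDiff.contMDiff (by fun_prop)).contMDiffAt
  have h3 : ContMDiffAt 𝓘(ℝ, ℝ × E × ℝ) 𝓘(ℝ, ℝ) ∞
      (fun q : ℝ × E × ℝ => q.2.2) (0, idChart E G 1, t) :=
    (ContDiff.contMDiff (by fun_prop)).contMDiffAt
  have h4 := (((h1.mul (contMDiffAt_const (c := x))).mul h2).prodMk h3).of_le (natCast_le_infty k)
  refine ContMDiffAt.contDiffAt (ContMDiffAt.comp_of_eq (I' := 𝓘(ℝ, E).prod 𝓘(ℝ, ℝ))
    (g := u) ?_ h4 rfl)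
  simpa only [conjCurve_zero, idChart_symm_one, one_mul, mul_one] using hu

end MeanCurvatureFlow

/-! ### The maximum principle at an interior point -/

namespace MeanCurvatureFlow

/-- Only earlier times are compared, since the maximum may sit at the final time of the truncated
cylinder. -/
theorem nonneg_of_hasDerivAt_of_eventually_le {f : ℝ → ℝ} {d t : ℝ} (hf : HasDerivAt f d t)
    (h : ∀ᶠ r in 𝓝 t, r ≤ t → f r ≤ f t) : 0 ≤ d := by
  have hmax : IsLocalMaxOn f (Iic t) t := by
    filter_upwards [nhdsWithin_le_nhds h, self_mem_nhdsWithin] with r h1 h2 using h1 h2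
  have hcone : (-1 : ℝ) ∈ posTangentConeAt (Iic t) t := by
    refine mem_posTangentConeAt_of_segment_subset ?_
    rw [segment_symm, segment_eq_Icc (by linarith)]
    exact fun r hr => hr.2
  have := hmax.hasFDerivWithinAt_nonpos hf.hasFDerivAt.hasFDerivWithinAt hcone
  simpa using this

theorem fderiv_comp_add_clm {V E : Type*} [NormedAddCommGroup V] [NormedSpace ℝ V]
    [NormedAddCommGroup E] [NormedSpace ℝ E] {W : Type*} [NormedAddCommGroup W] [NormedSpace ℝ W]
    {Φ : V → W} {a : V} (ι : E →L[ℝ] V) {y : E}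
    (h : DifferentiableAt ℝ Φ (a + ι y)) :
    fderiv ℝ (fun z => Φ (a + ι z)) y = (fderiv ℝ Φ (a + ι y)).comp ι := by
  have h1 : HasFDerivAt (fun z => a + ι z) ι y := ι.hasFDerivAt.const_add a
  exact (h.hasFDerivAt.comp y h1).fderiv

theorem fderiv_fderiv_comp_add_clm {V E : Type*} [NormedAddCommGroup V] [NormedSpace ℝ V]
    [NormedAddCommGroup E] [NormedSpace ℝ E]
    {Φ : V → ℝ} {a : V} (ι : E →L[ℝ] V) {y : E}
    (h : ContDiffAt ℝ 2 Φ (a + ι y)) (v w : E) :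
    fderiv ℝ (fderiv ℝ (fun z => Φ (a + ι z))) y v w =
      fderiv ℝ (fderiv ℝ Φ) (a + ι y) (ι v) (ι w) := by
  have hc : Tendsto (fun z => a + ι z) (𝓝 y) (𝓝 (a + ι y)) := by
    have : Continuous (fun z => a + ι z) := by fun_prop
    exact this.tendsto y
  have h1 : fderiv ℝ (fun z => Φ (a + ι z)) =ᶠ[𝓝 y] fun z => (fderiv ℝ Φ (a + ι z)).comp ι := by
    filter_upwards [hc.eventually (h.eventually (by simp))] with z hz
    exact fderiv_comp_add_clm ι (hz.differentiableAt (by simp))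
  have h2 : DifferentiableAt ℝ (fderiv ℝ Φ) (a + ι y) :=
    (h.fderiv_right (m := 1) (by norm_num)).differentiableAt (by simp)
  have h3 : HasFDerivAt (fun z => fderiv ℝ Φ (a + ι z))
      ((fderiv ℝ (fderiv ℝ Φ) (a + ι y)).comp ι) y :=
    h2.hasFDerivAt.comp y (ι.hasFDerivAt.const_add a)
  rw [h1.fderiv_eq, (h3.clm_comp (hasFDerivAt_const ι y)).fderiv]
  simp

theorem contMDiffAt_slice {E G : Type*} [NormedAddCommGroup E] [NormedSpace ℝ E]
    [TopologicalSpace G] [ChartedSpace E G] {u : G × ℝ → ℝ} {x : G} {t : ℝ} {k : ℕ∞ω}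
    (h : ContMDiffAt (𝓘(ℝ, E).prod 𝓘(ℝ, ℝ)) 𝓘(ℝ, ℝ) k u (x, t)) :
    ContMDiffAt 𝓘(ℝ, E) 𝓘(ℝ, ℝ) k (fun z => u (z, t)) x :=
  ContMDiffAt.comp x h (contMDiffAt_id.prodMk contMDiffAt_const)

variable {E G : Type*} [NormedAddCommGroup E] [NormedSpace ℝ E]
  [TopologicalSpace G] [ChartedSpace E G] [Group G]

/-- The derivative of `f` along the right invariant vector field whose flow consists of the left
translations by `conjCurve g w s`. -/
noncomputable def rightDeriv (g : G) (w : GroupLieAlgebra 𝓘(ℝ, E) G) (f : G → ℝ) (x : G) : ℝ :=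
  deriv (fun s => f (conjCurve g w s * x)) 0

/-- The inclusion of the spatial coordinates. -/
noncomputable def spaceIncl (E : Type*) [NormedAddCommGroup E] [NormedSpace ℝ E] :
    E →L[ℝ] ℝ × E × ℝ :=
  (ContinuousLinearMap.inr ℝ ℝ (E × ℝ)).comp (ContinuousLinearMap.inl ℝ E ℝ)

theorem spaceIncl_apply (z : E) : spaceIncl E z = (0, z, 0) := rfl

theorem flowChart_fderiv_flow {u : G × ℝ → ℝ} {g : G} {w : GroupLieAlgebra 𝓘(ℝ, E) G} {x : G}
    {y : E} {t : ℝ} (h : DifferentiableAt ℝ (flowChart u g w x) (0, y, t)) :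
    fderiv ℝ (flowChart u g w x) (0, y, t) (1, 0, 0) =
      rightDeriv g w (fun z => u (z, t)) (x * (idChart E G).symm y) := by
  have h1 := hasDerivAt_comp_line (p := ((0 : ℝ), y, t)) (a := ((1 : ℝ), (0 : E), (0 : ℝ)))
    (r := 0) (f := flowChart u g w x) (by simpa using h)
  have h2 := h1.deriv
  simp only [zero_smul, add_zero] at h2
  rw [← h2, rightDeriv]
  simp [flowChart, mul_assoc]

theorem flowChart_fderiv_time {u : G × ℝ → ℝ} {g : G} {w : GroupLieAlgebra 𝓘(ℝ, E) G} {x : G}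
    {s t : ℝ} (h : DifferentiableAt ℝ (flowChart u g w x) (s, idChart E G 1, t)) :
    fderiv ℝ (flowChart u g w x) (s, idChart E G 1, t) (0, 0, 1) =
      timeDeriv u (conjCurve g w s * x, t) := by
  have h1 := hasDerivAt_comp_line (p := (s, idChart E G 1, (0 : ℝ)))
    (a := ((0 : ℝ), (0 : E), (1 : ℝ))) (r := t) (f := flowChart u g w x) (by simpa using h)
  have h2 := h1.deriv
  simp only [Prod.smul_mk, smul_zero, Prod.mk_add_mk, add_zero, zero_add, smul_eq_mul,
    mul_one, mul_zero] at h2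
  rw [← h2, timeDeriv]
  simp only [flowChart, idChart_symm_one, mul_one]

variable [LieGroup 𝓘(ℝ, E) ∞ G]

/-- Translating `conjCurve g w s * x` to the identity turns left invariant derivatives into
derivatives of `flowChart` in the middle variable. The correction vector is independent of `s`,
which expresses that left and right invariant fields commute. -/
theorem flowChart_fderiv_space {u : G × ℝ → ℝ} {g : G} {w : GroupLieAlgebra 𝓘(ℝ, E) G} {x : G}
    {s t : ℝ} (hf : ContMDiffAt 𝓘(ℝ, E) 𝓘(ℝ, ℝ) 2 (fun z => u (z, t)) (conjCurve g w s * x))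
    (h : ContDiffAt ℝ 2 (flowChart u g w x) (s, idChart E G 1, t))
    (v v' : GroupLieAlgebra 𝓘(ℝ, E) G) :
    leftDeriv v (fun z => u (z, t)) (conjCurve g w s * x) =
      fderiv ℝ (flowChart u g w x) (s, idChart E G 1, t) (spaceIncl E v) ∧
    leftDeriv v (leftDeriv v' (fun z => u (z, t))) (conjCurve g w s * x) =
      fderiv ℝ (fderiv ℝ (flowChart u g w x)) (s, idChart E G 1, t)
        (spaceIncl E v) (spaceIncl E v') +
      fderiv ℝ (flowChart u g w x) (s, idChart E G 1, t)
        (spaceIncl E (fderiv ℝ (chartField v') (idChart E G 1) v)) := by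
  set a : G := conjCurve g w s * x with ha
  have hf' : ContMDiffAt 𝓘(ℝ, E) 𝓘(ℝ, ℝ) 2 (fun z => u (a * z, t)) 1 :=
    contMDiffAt_comp_mul_left (f := fun z => u (z, t)) (natCast_le_infty 2) a (by rwa [mul_one])
  have hfun : (fun z : E => u (a * (idChart E G).symm z, t)) =
      fun z => flowChart u g w x ((s, 0, t) + spaceIncl E z) := by
    funext z
    simp [flowChart, spaceIncl_apply, ha]
  have hpt : ((s, 0, t) : ℝ × E × ℝ) + spaceIncl E (idChart E G 1) = (s, idChart E G 1, t) := by
    simp only [spaceIncl_apply, Prod.mk_add_mk, add_zero, zero_add]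
  have hd1 := fderiv_comp_add_clm (a := (s, 0, t)) (y := idChart E G 1) (spaceIncl E)
    (Φ := flowChart u g w x) (by rw [hpt]; exact h.differentiableAt (by simp))
  have hd2 := fderiv_fderiv_comp_add_clm (a := (s, 0, t)) (y := idChart E G 1) (spaceIncl E)
    (Φ := flowChart u g w x) (by rwa [hpt])
  rw [hpt, ← hfun] at hd1
  simp only [hpt, ← hfun] at hd2
  have e1 : ∀ v : GroupLieAlgebra 𝓘(ℝ, E) G, leftDeriv v (fun z => u (z, t)) a = leftDeriv v (fun z => u (a * z, t)) 1 := by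
    intro v
    rw [leftDeriv_comp_mul_left (E := E) v (fun z => u (z, t)), mul_one]
  constructor
  · rw [e1, leftDeriv_one_eq_fderiv v (hf'.mdifferentiableAt (by simp)), hd1]
    rfl
  · have e2 : leftDeriv v (leftDeriv v' (fun z => u (z, t))) a =
        leftDeriv v (leftDeriv v' (fun z => u (a * z, t))) 1 := by
      have : leftDeriv v' (fun z => u (a * z, t)) =
          fun y => leftDeriv v' (fun z => u (z, t)) (a * y) :=
        funext fun y => leftDeriv_comp_mul_left v' (fun z => u (z, t)) a y
      rw [this, leftDeriv_comp_mul_left, mul_one]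
    rw [e2, leftDeriv_leftDeriv_one v v' hf', hd1]
    exact congrArg₂ (· + ·) (hd2 v v') rfl

variable {n m : ℕ}

/-- The parabolic maximum principle for right invariant derivatives of solutions. -/
theorem nonpos_of_rightDeriv_sub_le (F : StepTwoFrame E G n m) {ε : ℝ} {u : G × ℝ → ℝ} {x : G}
    {t : ℝ}
    (hu : ∀ᶠ p in 𝓝 (x, t), ContMDiffAt (𝓘(ℝ, E).prod 𝓘(ℝ, ℝ)) 𝓘(ℝ, ℝ) 3 u p)
    (heq : ∀ᶠ p in 𝓝 (x, t), timeDeriv u p = meanCurvature F ε (fun x => u (x, p.2)) p.1 *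
      areaElement F ε (fun x => u (x, p.2)) p.1)
    (g : G) (w : GroupLieAlgebra 𝓘(ℝ, E) G) {δ : ℝ}
    (hmax : ∀ᶠ p in 𝓝 (x, t), p.2 ≤ t → rightDeriv g w (fun z => u (z, p.2)) p.1 - δ * p.2 ≤
      rightDeriv g w (fun z => u (z, t)) x - δ * t) : δ ≤ 0 := by
  set Φ := flowChart u g w x with hΦ
  set κ1 : E := idChart E G 1 with hκ1
  have hΦ3 : ContDiffAt ℝ 3 Φ (0, κ1, t) := contDiffAt_flowChart (k := 3) hu.self_of_nhds g w
  have hΦev : ∀ᶠ q in 𝓝 ((0, κ1, t) : ℝ × E × ℝ), ContDiffAt ℝ 3 Φ q := hΦ3.eventually (by simp)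
  have hs : Tendsto (fun s : ℝ => ((s, κ1, t) : ℝ × E × ℝ)) (𝓝 0) (𝓝 (0, κ1, t)) :=
    (by fun_prop : Continuous fun s : ℝ => ((s, κ1, t) : ℝ × E × ℝ)).tendsto 0
  have hx : Tendsto (fun s : ℝ => (conjCurve g w s * x, t)) (𝓝 0) (𝓝 (x, t)) := by
    have h1 : ContinuousAt (conjCurve g w) 0 := (contMDiffAt_conjCurve g w).continuousAt
    have h2 : ContinuousAt (fun y : G => y * x) (conjCurve g w 0) :=
      (contMDiff_mul_right (I := 𝓘(ℝ, E)) (n := ∞) (a := x)).continuous.continuousAt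
    have h3 : Tendsto (fun s : ℝ => conjCurve g w s * x) (𝓝 0) (𝓝 x) := by
      have : Tendsto (fun s : ℝ => conjCurve g w s * x) (𝓝 0) (𝓝 (conjCurve g w 0 * x)) :=
        h2.comp h1
      rwa [conjCurve_zero, one_mul] at this
    exact h3.prodMk_nhds tendsto_const_nhds
  have hline : ∀ s : ℝ, ((0, κ1, t) : ℝ × E × ℝ) + s • ((1, 0, 0) : ℝ × E × ℝ) = (s, κ1, t) := by
    intro s; simp
  have hGmax : ∀ᶠ q in 𝓝 ((κ1, t) : E × ℝ), q.2 ≤ t →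
      fderiv ℝ Φ (0, q.1, q.2) (1, 0, 0) - δ * q.2 ≤
        fderiv ℝ Φ (0, κ1, t) (1, 0, 0) - δ * t := by
    have h1 : Tendsto (fun q : E × ℝ => ((0, q.1, q.2) : ℝ × E × ℝ)) (𝓝 (κ1, t))
        (𝓝 (0, κ1, t)) :=
      (by fun_prop : Continuous fun q : E × ℝ => ((0, q.1, q.2) : ℝ × E × ℝ)).tendsto (κ1, t)
    have h2 : Tendsto (fun q : E × ℝ => (x * (idChart E G).symm q.1, q.2)) (𝓝 (κ1, t))
        (𝓝 (x, t)) := by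
      have h3 : ContinuousAt (idChart E G).symm κ1 :=
        (contMDiffAt_idChart_symm idChart_one_mem_target).continuousAt
      have h4 : ContinuousAt (fun y : G => x * y) ((idChart E G).symm κ1) :=
        (contMDiff_mul_left (I := 𝓘(ℝ, E)) (n := ∞) (a := x)).continuous.continuousAt
      have h5 : Tendsto (fun y : E => x * (idChart E G).symm y) (𝓝 κ1) (𝓝 x) := by
        have : Tendsto (fun y : E => x * (idChart E G).symm y) (𝓝 κ1)
            (𝓝 (x * (idChart E G).symm κ1)) := h4.comp h3
        rwa [hκ1, idChart_symm_one, mul_one] at this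
      exact (h5.comp (continuous_fst.tendsto (κ1, t))).prodMk_nhds (continuous_snd.tendsto (κ1, t))
    filter_upwards [h1.eventually hΦev, h2.eventually hmax] with q hq1 hq2 hqt
    rw [flowChart_fderiv_flow (hq1.differentiableAt (by simp)),
      flowChart_fderiv_flow (hΦ3.differentiableAt (by simp)), hκ1, idChart_symm_one, mul_one]
    exact hq2 hqt
  -- At the fixed time `t` the term `δ * t` is constant, so `∂_s Φ` itself has a spatial maximum.
  have hspace : ∀ z, IsLocalMax
      (fun r : ℝ => fderiv ℝ Φ ((0, κ1, t) + r • spaceIncl E z) (1, 0, 0)) 0 := by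
    intro z
    have h1 : Tendsto (fun r : ℝ => ((κ1 + r • z, t) : E × ℝ)) (𝓝 0) (𝓝 (κ1, t)) := by
      have := (by fun_prop : Continuous fun r : ℝ => ((κ1 + r • z, t) : E × ℝ)).tendsto 0
      simpa using this
    filter_upwards [h1.eventually hGmax] with r hr
    have := hr le_rfl
    simp only [spaceIncl_apply, Prod.smul_mk, smul_zero, Prod.mk_add_mk, add_zero, zero_smul]
    linarith
  -- Comparison with earlier times gives `∂_t ∂_s Φ ≥ δ`; the spatial maximum and the equation will
  -- give `∂_t ∂_s Φ ≤ 0`.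
  have htime : 0 ≤ fderiv ℝ (fun q => fderiv ℝ Φ q (1, 0, 0)) (0, κ1, t) (0, 0, 1) - δ := by
    have hd : DifferentiableAt ℝ (fun q => fderiv ℝ Φ q (1, 0, 0)) (0, κ1, t) :=
      ((hΦ3.fderiv_right (m := 2) (by norm_num)).clm_apply contDiffAt_const).differentiableAt
        (by simp)
    have hl : ∀ r : ℝ, ((0, κ1, 0) : ℝ × E × ℝ) + r • ((0, 0, 1) : ℝ × E × ℝ) = (0, κ1, r) := by
      intro r; simp
    have h1 := hasDerivAt_comp_line (p := ((0, κ1, 0) : ℝ × E × ℝ))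
      (a := ((0, 0, 1) : ℝ × E × ℝ)) (r := t) (f := fun q => fderiv ℝ Φ q (1, 0, 0))
      (by rwa [hl])
    simp only [hl] at h1
    have h2 := h1.fun_sub ((hasDerivAt_id t).const_mul δ)
    rw [mul_one] at h2
    refine nonneg_of_hasDerivAt_of_eventually_le h2 ?_
    have h3 : Tendsto (fun r : ℝ => ((κ1, r) : E × ℝ)) (𝓝 t) (𝓝 (κ1, t)) :=
      (by fun_prop : Continuous fun r : ℝ => ((κ1, r) : E × ℝ)).tendsto t
    exact h3.eventually hGmax
  let vec : Fin n → GroupLieAlgebra 𝓘(ℝ, E) G := fun i =>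
    (if i.val < m then (1 : ℝ) else ε) • F.X i
  have hev : ∀ᶠ s in 𝓝 (0 : ℝ), ContDiffAt ℝ 2 Φ (s, κ1, t) ∧
      ContMDiffAt 𝓘(ℝ, E) 𝓘(ℝ, ℝ) 2 (fun z => u (z, t)) (conjCurve g w s * x) := by
    filter_upwards [hs.eventually hΦev, hx.eventually hu] with s h1 h2
    exact ⟨h1.of_le (by norm_num), (contMDiffAt_slice h2).of_le (by norm_num)⟩
  have key := fderiv_fderiv_apply_nonpos_of_quasilinear hΦ3 (e := (1, 0, 0)) (τ := (0, 0, 1))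
    (spaceIncl E) hspace (n := n) vec
    (fun i j => fderiv ℝ (chartField (vec j)) κ1 (vec i))
    (P := fun i s => frameDeriv F ε i (fun z => u (z, t)) (conjCurve g w s * x))
    (q := fun i j s => frameDeriv F ε i (frameDeriv F ε j (fun z => u (z, t)))
      (conjCurve g w s * x))
    (fun i => by
      filter_upwards [hev] with s h1
      rw [hline]
      exact (flowChart_fderiv_space h1.2 h1.1 (vec i) (vec i)).1)
    (fun i j => by
      filter_upwards [hev] with s h1
      rw [hline]
      exact (flowChart_fderiv_space h1.2 h1.1 (vec i) (vec j)).2)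
    (by
      filter_upwards [hev, hx.eventually heq] with s h1 h2
      rw [hline, flowChart_fderiv_time (h1.1.differentiableAt (by simp)), h2,
        meanCurvature_mul_areaElement F ε h1.2])
  linarith

end MeanCurvatureFlow

/-! ### The adjoint action and the comparison of right with left derivatives -/

namespace MeanCurvatureFlow

variable {E G : Type*} [NormedAddCommGroup E] [NormedSpace ℝ E]
  [TopologicalSpace G] [ChartedSpace E G] [Group G]

/-- Conjugation by `b⁻¹` in the chart at the identity. -/
noncomputable def chartConj (E : Type*) {G : Type*} [NormedAddCommGroup E] [NormedSpace ℝ E]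
    [TopologicalSpace G] [ChartedSpace E G] [Group G] (b : G) (z : E) : E :=
  idChart E G (b⁻¹ * (idChart E G).symm z * b)

/-- The adjoint action of `b⁻¹` on the Lie algebra. -/
noncomputable def conjVector (b : G) (w : GroupLieAlgebra 𝓘(ℝ, E) G) :
    GroupLieAlgebra 𝓘(ℝ, E) G :=
  fderiv ℝ (chartConj E b) (idChart E G 1) w

theorem chartConj_one (b : G) : chartConj E b (idChart E G 1) = idChart E G 1 := by
  rw [chartConj, idChart_symm_one, mul_one, inv_mul_cancel]

theorem conjVector_sum_smul (b : G) {n : ℕ} (c : Fin n → ℝ)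
    (w : Fin n → GroupLieAlgebra 𝓘(ℝ, E) G) :
    conjVector b (∑ i, c i • w i) = ∑ i, c i • conjVector b (w i) := by
  have h : ∀ w : Fin n → E, fderiv ℝ (chartConj E b) (idChart E G 1) (∑ i, c i • w i) =
      ∑ i, c i • fderiv ℝ (chartConj E b) (idChart E G 1) (w i) := by
    intro w; simp only [map_sum, map_smul]
  exact h w

theorem conjVector_neg (b : G) (w : GroupLieAlgebra 𝓘(ℝ, E) G) :
    conjVector b (-w) = -conjVector b w := by
  have h : ∀ w : E, fderiv ℝ (chartConj E b) (idChart E G 1) (-w) =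
      -fderiv ℝ (chartConj E b) (idChart E G 1) w := fun w => map_neg _ w
  exact h w

/-- The left invariant derivative as a linear function of the generating vector. -/
noncomputable def leftDerivLinear (f : G → ℝ) (x : G) : GroupLieAlgebra 𝓘(ℝ, E) G →ₗ[ℝ] ℝ where
  toFun v := leftDeriv v f x
  map_add' v w := by
    have := (mfderiv 𝓘(ℝ, E) 𝓘(ℝ, ℝ) f x).map_add (mulInvariantVectorField v x)
      (mulInvariantVectorField w x)
    simp only [leftDeriv, mulInvariantVectorField_add]
    exact this
  map_smul' c v := by
    have := (mfderiv 𝓘(ℝ, E) 𝓘(ℝ, ℝ) f x).map_smul c (mulInvariantVectorField v x)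
    simp only [leftDeriv, mulInvariantVectorField_smul]
    exact this

theorem leftDeriv_sum_smul (f : G → ℝ) (x : G) {n : ℕ} (c : Fin n → ℝ)
    (w : Fin n → GroupLieAlgebra 𝓘(ℝ, E) G) :
    leftDeriv (∑ i, c i • w i) f x = ∑ i, c i * leftDeriv (w i) f x := by
  have h := map_sum (leftDerivLinear (E := E) f x) (fun i => c i • w i) Finset.univ
  simp only [map_smul, smul_eq_mul] at h
  exact h

theorem continuousAt_idChart_one : ContinuousAt (idChart E G) 1 :=
  continuousAt_extChartAt (I := 𝓘(ℝ, E)) (1 : G)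

variable [LieGroup 𝓘(ℝ, E) ∞ G]

theorem contDiffAt_chartConj_param (b : G) :
    ContDiffAt ℝ ∞ (fun p : E × E => chartConj E (b * (idChart E G).symm p.1) p.2)
      (idChart E G 1, idChart E G 1) := by
  have h1 : ContMDiffAt 𝓘(ℝ, E × E) 𝓘(ℝ, E) ∞ (fun p : E × E => (idChart E G).symm p.1)
      (idChart E G 1, idChart E G 1) :=
    ContMDiffAt.comp (I' := 𝓘(ℝ, E)) _ (contMDiffAt_idChart_symm idChart_one_mem_target)
      contDiffAt_fst.contMDiffAt
  have h2 : ContMDiffAt 𝓘(ℝ, E × E) 𝓘(ℝ, E) ∞ (fun p : E × E => (idChart E G).symm p.2)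
      (idChart E G 1, idChart E G 1) :=
    ContMDiffAt.comp (I' := 𝓘(ℝ, E)) _ (contMDiffAt_idChart_symm idChart_one_mem_target)
      contDiffAt_snd.contMDiffAt
  have h3 := (contMDiffAt_const (c := b)).mul h1
  have h4 := (h3.inv.mul h2).mul h3
  refine ContMDiffAt.contDiffAt (ContMDiffAt.comp_of_eq (I' := 𝓘(ℝ, E)) (g := idChart E G) (y := 1)
    (contMDiffAt_idChart (mem_extChartAt_source (I := 𝓘(ℝ, E)) (1 : G))) h4 ?_)
  simp

theorem contDiffAt_chartConj (b : G) : ContDiffAt ℝ ∞ (chartConj E b) (idChart E G 1) := by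
  have h := (contDiffAt_chartConj_param (E := E) b).comp (idChart E G 1)
    (f := fun z : E => (idChart E G 1, z)) (by fun_prop)
  refine h.congr_of_eventuallyEq (Eventually.of_forall fun z => ?_)
  simp only [Function.comp, idChart_symm_one, mul_one]

/-- Near `b`, the parameter is written as `b * κ⁻¹ y`; joint smoothness in `y` and the conjugated
point makes the derivative at the identity continuous in `y`. This continuity bounds the adjoint
action on compact sets. -/
theorem continuous_fderiv_chartConj :
    Continuous fun b : G => fderiv ℝ (chartConj E b) (idChart E G 1) := by
  have : IsTopologicalGroup G := topologicalGroup_of_lieGroup 𝓘(ℝ, E) ∞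
  refine continuous_iff_continuousAt.2 fun b => ?_
  have h := (ContDiffAt.fderiv (f := fun y z : E => chartConj E (b * (idChart E G).symm y) z)
    (g := fun _ => idChart E G 1) (m := ∞) (x₀ := idChart E G 1)
    (contDiffAt_chartConj_param b) contDiffAt_const (by simp)).continuousAt
  have hb : Tendsto (fun b' : G => b⁻¹ * b') (𝓝 b) (𝓝 1) := by
    have := (continuous_const_mul b⁻¹).tendsto b
    rwa [inv_mul_cancel] at this
  have hc : Tendsto (fun b' : G => idChart E G (b⁻¹ * b')) (𝓝 b) (𝓝 (idChart E G 1)) :=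
    (continuousAt_idChart_one (E := E)).tendsto.comp hb
  have h2 := h.tendsto.comp hc
  simp only [idChart_symm_one, mul_one] at h2
  refine Tendsto.congr' ?_ h2
  filter_upwards [hb (extChartAt_source_mem_nhds (I := 𝓘(ℝ, E)) (1 : G))] with b' hb'
  simp only [Function.comp]
  rw [(idChart E G).left_inv hb', mul_inv_cancel_left]

theorem eventually_conj_mem_source (b : G) : ∀ᶠ z in 𝓝 (idChart E G 1),
    b⁻¹ * (idChart E G).symm z * b ∈ (idChart E G).source := by
  have : IsTopologicalGroup G := topologicalGroup_of_lieGroup 𝓘(ℝ, E) ∞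
  have h1 : ContinuousAt (idChart E G).symm (idChart E G 1) :=
    (contMDiffAt_idChart_symm idChart_one_mem_target).continuousAt
  have h2 : Tendsto (fun z : E => b⁻¹ * (idChart E G).symm z * b) (𝓝 (idChart E G 1)) (𝓝 1) := by
    have : Tendsto (fun z : E => b⁻¹ * (idChart E G).symm z * b) (𝓝 (idChart E G 1))
        (𝓝 (b⁻¹ * (idChart E G).symm (idChart E G 1) * b)) := (h1.const_mul b⁻¹).mul_const b
    rwa [idChart_symm_one, mul_one, inv_mul_cancel] at this
  exact h2 (extChartAt_source_mem_nhds (I := 𝓘(ℝ, E)) (1 : G))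

theorem conjVector_conjVector_inv (b : G) (w : GroupLieAlgebra 𝓘(ℝ, E) G) :
    conjVector b (conjVector b⁻¹ w) = w := by
  have hd : ∀ b : G, DifferentiableAt ℝ (chartConj E b) (idChart E G 1) := fun b =>
    (contDiffAt_chartConj b).differentiableAt (by simp)
  have hev : chartConj E b ∘ chartConj E b⁻¹ =ᶠ[𝓝 (idChart E G 1)] id := by
    filter_upwards [eventually_conj_mem_source (E := E) b⁻¹,
      eventually_mem_target (E := E) (G := G)] with z hz hz'
    simp only [Function.comp, id, chartConj]
    rw [(idChart E G).left_inv hz]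
    have : b⁻¹ * (b⁻¹⁻¹ * (idChart E G).symm z * b⁻¹) * b = (idChart E G).symm z := by group
    rw [this, (idChart E G).right_inv hz']
  have h1 : DifferentiableAt ℝ (chartConj E b) (chartConj E b⁻¹ (idChart E G 1)) := by
    rw [chartConj_one]; exact hd b
  have h2 := hev.fderiv_eq (𝕜 := ℝ)
  rw [fderiv_comp _ h1 (hd b⁻¹), fderiv_id, chartConj_one] at h2
  have h3 : ∀ z : E, fderiv ℝ (chartConj E b) (idChart E G 1)
      (fderiv ℝ (chartConj E b⁻¹) (idChart E G 1) z) = z := fun z => DFunLike.congr_fun h2 z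
  exact h3 w

/-- With `b = g⁻¹ * x` one has `g * η * g⁻¹ * x = x * (b⁻¹ * η * b)`: a left translation of `x` is a
right translation by a conjugate. The base point enters the vector only through `g⁻¹ * x`. -/
theorem rightDeriv_eq_leftDeriv (g : G) (w : GroupLieAlgebra 𝓘(ℝ, E) G) {f : G → ℝ} {x : G}
    (hf : ContMDiffAt 𝓘(ℝ, E) 𝓘(ℝ, ℝ) 1 f x) :
    rightDeriv g w f x = leftDeriv (conjVector (g⁻¹ * x) w) f x := by
  set b := g⁻¹ * x with hb
  have hfx : ContMDiffAt 𝓘(ℝ, E) 𝓘(ℝ, ℝ) 1 (fun y => f (x * y)) 1 :=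
    contMDiffAt_comp_mul_left (natCast_le_infty 1) x (by rwa [mul_one])
  have hd : DifferentiableAt ℝ (fun z => f (x * (idChart E G).symm z)) (idChart E G 1) :=
    (contDiffAt_comp_idChart_symm (f := fun y => f (x * y)) (natCast_le_infty 1)
      idChart_one_mem_target (by rwa [idChart_symm_one])).differentiableAt (by simp)
  have h1 : leftDeriv (conjVector b w) f x = leftDeriv (conjVector b w) (fun y => f (x * y)) 1 := by
    rw [leftDeriv_comp_mul_left, mul_one]
  have hline : ∀ w : E, HasDerivAt (fun s : ℝ => f (x * (idChart E G).symm
      (chartConj E b (idChart E G 1 + s • w))))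
      (fderiv ℝ (fun z => f (x * (idChart E G).symm z)) (idChart E G 1)
        (fderiv ℝ (chartConj E b) (idChart E G 1) w)) 0 := by
    intro w
    have hd' : DifferentiableAt ℝ (fun z => f (x * (idChart E G).symm z))
        (chartConj E b (idChart E G 1)) := by rwa [chartConj_one]
    have hc := (contDiffAt_chartConj (E := E) b).differentiableAt (by simp)
    have h3 := hasDerivAt_comp_line (p := idChart E G 1) (a := w) (r := 0)
      (f := (fun z => f (x * (idChart E G).symm z)) ∘ chartConj E b)
      (by rw [zero_smul, add_zero]; exact hd'.comp _ hc)
    rw [zero_smul, add_zero, fderiv_comp _ hd' hc, chartConj_one] at h3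
    exact h3
  have hev : ∀ w : E, (fun s : ℝ => f (g * chartPoint G (s • w) * g⁻¹ * x)) =ᶠ[𝓝 0]
      fun s => f (x * (idChart E G).symm (chartConj E b (idChart E G 1 + s • w))) := by
    intro w
    filter_upwards [(tendsto_line (idChart E G 1) w).eventually
      (eventually_conj_mem_source (E := E) b)] with s hs
    rw [chartConj, (idChart E G).left_inv hs, chartPoint, hb]
    congr 1
    group
  rw [h1, leftDeriv_one_eq_fderiv _ (hfx.mdifferentiableAt (by simp))]
  exact ((hline w).congr_of_eventuallyEq (hev w)).deriv

end MeanCurvatureFlow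

/-! ### The weak maximum principle and the gradient bound on the cylinder -/

namespace MeanCurvatureFlow

/-- Inseparable points share a chart, whose values in `E` must agree; so the group is T0, hence
Hausdorff. This makes compact translates `g • B` closed, so that they contain `closure Ω`. -/
theorem t2Space_of_isTopologicalGroup_of_chartedSpace (E G : Type*) [NormedAddCommGroup E]
    [NormedSpace ℝ E] [TopologicalSpace G] [ChartedSpace E G] [Group G] [IsTopologicalGroup G] :
    T2Space G := by
  suffices T0Space G by infer_instance
  refine ⟨fun x y hxy => ?_⟩
  have hy : y ∈ (chartAt E x).source :=
    (hxy.mem_open_iff (chartAt E x).open_source).1 (mem_chart_source E x)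
  refine (chartAt E x).injOn (mem_chart_source E x) hy ?_
  have h1 : Inseparable (⟨x, mem_chart_source E x⟩ : (chartAt E x).source) ⟨y, hy⟩ :=
    Topology.IsInducing.subtypeVal.inseparable_iff.1 hxy
  have h2 : Continuous ((chartAt E x).source.domRestrict (chartAt E x)) :=
    (chartAt E x).continuousOn.domRestrict
  exact (h1.map h2).eq

/-- Shows that the continuous extensions agree with the original functions inside `Q`. -/
theorem eq_of_tendsto_nhdsWithin_of_mem {X Y : Type*} [TopologicalSpace X] [TopologicalSpace Y]
    [T2Space Y] {A : Set X} {f : X → Y} {p : X} {l : Y} (hp : p ∈ A)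
    (h : Tendsto f (𝓝[A] p) (𝓝 l)) : f p = l :=
  tendsto_nhds_unique (tendsto_pure_nhds f p) (h.mono_left (pure_le_nhdsWithin hp))

section Cylinder

variable {G : Type*} [TopologicalSpace G]

theorem closure_prod_subset_closure_cylinder (Ω : Set G) {T : ℝ} (hT : 0 < T) :
    closure Ω ×ˢ Ico 0 T ⊆ closure (cylinder Ω T) := by
  rw [cylinder, closure_prod_eq, closure_Ioo hT.ne]
  exact prod_mono le_rfl Ico_subset_Icc_self

theorem parabolicBoundary_subset (Ω : Set G) {T : ℝ} (hT : 0 < T) :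
    parabolicBoundary Ω T ⊆ closure Ω ×ˢ Ico 0 T := by
  rintro ⟨x, t⟩ (⟨hx, ht⟩ | ⟨hx, ht⟩)
  · obtain rfl : t = 0 := ht
    exact ⟨subset_closure hx, le_rfl, hT⟩
  · exact ⟨frontier_subset_closure hx, ht.1.le, ht.2⟩

theorem cylinder_subset (Ω : Set G) (T : ℝ) : cylinder Ω T ⊆ closure Ω ×ˢ Ico 0 T :=
  prod_mono subset_closure Ioo_subset_Ico_self

end Cylinder

variable {E G : Type*} [NormedAddCommGroup E] [NormedSpace ℝ E]
  [TopologicalSpace G] [ChartedSpace E G] [Group G]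

theorem timeSpeed_nonneg {G : Type*} [TopologicalSpace G] {Ω : Set G} {T : ℝ} (hT : 0 < T) {u : G × ℝ → ℝ}
    (h : ExtendsContinuously (cylinder Ω T) (parabolicBoundary Ω T) (timeDeriv u)) {p : G × ℝ}
    (hp : p ∈ parabolicBoundary Ω T) : 0 ≤ timeSpeed Ω T u p := by
  obtain ⟨l, hl⟩ := h p hp
  have hcl := closure_prod_subset_closure_cylinder Ω hT (parabolicBoundary_subset Ω hT hp)
  rw [timeSpeed, extendFrom_eq hcl hl.abs]
  exact abs_nonneg l

variable {n m : ℕ}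

theorem frameDeriv_one (F : StepTwoFrame E G n m) (i : Fin n) (f : G → ℝ) :
    frameDeriv F 1 i f = leftDeriv (F.X i) f := by
  simp [frameDeriv]

theorem spaceGrad_eq (F : StepTwoFrame E G n m) {Ω : Set G} {T : ℝ} (hT : 0 < T) {u : G × ℝ → ℝ}
    (h : ∀ i, ExtendsContinuously (cylinder Ω T) (closure Ω ×ˢ Ico 0 T) (spaceDeriv F i u))
    {p : G × ℝ} (hp : p ∈ closure Ω ×ˢ Ico 0 T) :
    spaceGrad F Ω T u p =
      Real.sqrt (∑ i, extendFrom (cylinder Ω T) (spaceDeriv F i u) p ^ 2) := by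
  have hcl := closure_prod_subset_closure_cylinder Ω hT hp
  rw [spaceGrad]
  refine extendFrom_eq hcl ?_
  exact (Real.continuous_sqrt.tendsto _).comp
    (tendsto_finsetSum _ fun i _ => (tendsto_extendFrom (h i p hp)).pow 2)

variable [LieGroup 𝓘(ℝ, E) ∞ G]

theorem continuous_coord_conjVector [FiniteDimensional ℝ E]
    (ℓ : GroupLieAlgebra 𝓘(ℝ, E) G →ₗ[ℝ] ℝ) (w : GroupLieAlgebra 𝓘(ℝ, E) G) :
    Continuous fun b : G => ℓ (conjVector b w) := by
  have h : ∀ (ℓ : E →ₗ[ℝ] ℝ) (w : E),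
      Continuous fun b : G => ℓ (fderiv ℝ (chartConj E b) (idChart E G 1) w) := fun ℓ w =>
    ℓ.continuous_of_finiteDimensional.comp (continuous_fderiv_chartConj.clm_apply continuous_const)
  exact h ℓ w

/-- The weak maximum principle for right invariant derivatives of solutions. -/
theorem le_of_le_on_parabolicBoundary (F : StepTwoFrame E G n m) {ε : ℝ} {u : G × ℝ → ℝ}
    {Ω : Set G} (hΩ : IsOpen Ω) (hc : IsCompact (closure Ω)) {T : ℝ} (hT : 0 < T)
    (hu : ContMDiffOn (𝓘(ℝ, E).prod 𝓘(ℝ, ℝ)) 𝓘(ℝ, ℝ) 3 u (cylinder Ω T))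
    (heq : ∀ p ∈ cylinder Ω T, timeDeriv u p =
      meanCurvature F ε (fun x => u (x, p.2)) p.1 * areaElement F ε (fun x => u (x, p.2)) p.1)
    (g : G) (w : GroupLieAlgebra 𝓘(ℝ, E) G) {V : G × ℝ → ℝ}
    (hV : ContinuousOn V (closure Ω ×ˢ Ico 0 T))
    (hVu : ∀ p ∈ cylinder Ω T, V p = rightDeriv g w (fun z => u (z, p.2)) p.1) {k : ℝ}
    (hk : ∀ p ∈ parabolicBoundary Ω T, V p ≤ k) : ∀ p ∈ cylinder Ω T, V p ≤ k := by
  rintro ⟨x₁, t₁⟩ ⟨hx₁, ht₁⟩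
  by_contra! hlt
  have ht₁0 : 0 < t₁ := ht₁.1
  -- Chosen so that `δ * t₁` is half the excess over `k`: the maximum of `V - δ t` still has `V >
  -- k`. Stopping at `t₁ < T` keeps the domain compact.
  set δ := (V (x₁, t₁) - k) / (2 * t₁) with hδ
  have hδ0 : 0 < δ := div_pos (by linarith) (by linarith)
  have hδt : δ * t₁ = (V (x₁, t₁) - k) / 2 := by rw [hδ]; field_simp
  have hsub : closure Ω ×ˢ Icc 0 t₁ ⊆ closure Ω ×ˢ Ico 0 T :=
    prod_mono le_rfl fun t ht => ⟨ht.1, ht.2.trans_lt ht₁.2⟩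
  have hcont : ContinuousOn (fun p : G × ℝ => V p - δ * p.2) (closure Ω ×ˢ Icc 0 t₁) :=
    (hV.mono hsub).sub (by fun_prop)
  have hmem : (x₁, t₁) ∈ closure Ω ×ˢ Icc 0 t₁ := ⟨subset_closure hx₁, ht₁0.le, le_rfl⟩
  obtain ⟨⟨x₀, t₀⟩, ⟨hx₀, ht₀⟩, hmax⟩ :=
    (hc.prod isCompact_Icc).exists_isMaxOn ⟨_, hmem⟩ hcont
  have h0 : k < V (x₀, t₀) := by
    have h1 : V (x₁, t₁) - δ * t₁ ≤ V (x₀, t₀) - δ * t₀ := hmax hmem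
    have h2 : 0 ≤ δ * t₀ := mul_nonneg hδ0.le ht₀.1
    linarith
  have ht₀T : t₀ < T := ht₀.2.trans_lt ht₁.2
  rcases ht₀.1.eq_or_lt with rfl | ht₀0
  -- The parabolic boundary omits `∂Ω × {0}`; there the bound follows from `Ω × {0}` by continuity.
  · have hb : ContinuousOn (fun x => V (x, 0)) (closure Ω) :=
      hV.comp (by fun_prop) fun x hx => ⟨hx, le_rfl, hT⟩
    exact absurd (le_on_closure (fun x hx => hk (x, 0) (Or.inl ⟨hx, rfl⟩)) hb continuousOn_const
      hx₀) h0.not_ge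
  by_cases hxΩ : x₀ ∈ Ω
  · have hQ : cylinder Ω T ∈ 𝓝 (x₀, t₀) :=
      (hΩ.prod isOpen_Ioo).mem_nhds ⟨hxΩ, ht₀0, ht₀T⟩
    have hp₀ : (x₀, t₀) ∈ cylinder Ω T := mem_of_mem_nhds hQ
    refine hδ0.not_ge (nonpos_of_rightDeriv_sub_le F (u := u) (x := x₀) (t := t₀) (ε := ε)
      ?_ ?_ g w ?_)
    · filter_upwards [hΩ.prod isOpen_Ioo |>.mem_nhds hp₀] with p hp
      exact hu.contMDiffAt ((hΩ.prod isOpen_Ioo).mem_nhds hp)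
    · filter_upwards [hQ] with p hp using heq p hp
    · filter_upwards [hQ] with p hp hpt
      rw [← hVu p hp, ← hVu (x₀, t₀) hp₀]
      exact hmax ⟨subset_closure hp.1, hp.2.1.le, hpt.trans ht₀.2⟩
  · refine absurd (hk (x₀, t₀) (Or.inr ⟨⟨hx₀, ?_⟩, ht₀0, ht₀T⟩)) h0.not_ge
    rwa [hΩ.interior_eq]

/-- The gradient bound, in terms of a bound `M` for the coefficients of the adjoint action. -/
theorem spaceGrad_le_of_bound (F : StepTwoFrame E G n m) [FiniteDimensional ℝ E] {ε : ℝ}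
    {Ω : Set G} (hΩ : IsOpen Ω) (hc : IsCompact (closure Ω)) {T : ℝ} (hT : 0 < T)
    {φ : G → ℝ} {u : G × ℝ → ℝ} (hu : IsSolution F ε Ω T φ u) (g : G) {M : ℝ}
    (hM : ∀ x ∈ closure Ω, ∀ i j, |F.X.coord i (conjVector (g⁻¹ * x) (F.X j))| ≤ M)
    (hM' : ∀ x ∈ closure Ω, ∀ i j, |F.X.coord j (conjVector (g⁻¹ * x)⁻¹ (F.X i))| ≤ M) {s : ℝ}
    (hs : ∀ p ∈ parabolicBoundary Ω T, spaceGrad F Ω T u p ≤ s) :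
    ∀ p ∈ cylinder Ω T, spaceGrad F Ω T u p ≤ n * (n * (M * (n * (M * s)))) := by
  have : IsTopologicalGroup G := topologicalGroup_of_lieGroup 𝓘(ℝ, E) ∞
  set D : Fin n → G × ℝ → ℝ := fun i => extendFrom (cylinder Ω T) (spaceDeriv F i u) with hD
  have hDcont : ∀ i, ContinuousOn (D i) (closure Ω ×ˢ Ico 0 T) := fun i =>
    continuousOn_extendFrom (closure_prod_subset_closure_cylinder Ω hT) (hu.space_extends i)
  have hDQ : ∀ i, ∀ p ∈ cylinder Ω T, D i p = leftDeriv (F.X i) (fun x => u (x, p.2)) p.1 := by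
    intro i p hp
    have h1 := eq_of_tendsto_nhdsWithin_of_mem hp
      (tendsto_extendFrom (hu.space_extends i p (cylinder_subset Ω T hp)))
    rw [hD, ← frameDeriv_one]
    exact h1.symm
  have hgrad : ∀ p ∈ closure Ω ×ˢ Ico 0 T, spaceGrad F Ω T u p = Real.sqrt (∑ i, D i p ^ 2) :=
    fun p hp => spaceGrad_eq F hT hu.space_extends hp
  have hDs : ∀ i, ∀ p ∈ parabolicBoundary Ω T, |D i p| ≤ s := by
    intro i p hp
    refine le_trans ?_ (hs p hp)
    rw [hgrad p (parabolicBoundary_subset Ω hT hp)]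
    refine Real.le_sqrt_of_sq_le ?_
    rw [sq_abs]
    exact Finset.single_le_sum (f := fun i => D i p ^ 2) (fun i _ => sq_nonneg _)
      (Finset.mem_univ i)
  -- The right invariant derivative expanded in the left invariant frame, a form that makes sense
  -- and is continuous up to the boundary.
  let V : GroupLieAlgebra 𝓘(ℝ, E) G → G × ℝ → ℝ := fun w p =>
    ∑ i, F.X.coord i (conjVector (g⁻¹ * p.1) w) * D i p
  have hVcont : ∀ w, ContinuousOn (V w) (closure Ω ×ˢ Ico 0 T) := by
    intro w
    refine continuousOn_finsetSum _ fun i _ => ContinuousOn.mul ?_ (hDcont i)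
    exact ((continuous_coord_conjVector (F.X.coord i) w).comp
      (by fun_prop : Continuous fun p : G × ℝ => g⁻¹ * p.1)).continuousOn
  have hVu : ∀ w, ∀ p ∈ cylinder Ω T, V w p = rightDeriv g w (fun z => u (z, p.2)) p.1 := by
    intro w p hp
    have hC1 : ContMDiffAt 𝓘(ℝ, E) 𝓘(ℝ, ℝ) 1 (fun z => u (z, p.2)) p.1 :=
      (contMDiffAt_slice (hu.smooth.contMDiffAt ((hΩ.prod isOpen_Ioo).mem_nhds hp))).of_le
        (by norm_num)
    rw [rightDeriv_eq_leftDeriv g w hC1]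
    conv_rhs => rw [← F.X.sum_repr (conjVector (g⁻¹ * p.1) w)]
    rw [leftDeriv_sum_smul]
    exact Finset.sum_congr rfl fun i _ => by rw [hDQ i p hp]; rfl
  have hVneg : ∀ w p, V (-w) p = -V w p := by
    intro w p
    simp only [V, conjVector_neg, map_neg, neg_mul, Finset.sum_neg_distrib]
  have hVle : ∀ j, ∀ p ∈ cylinder Ω T, |V (F.X j) p| ≤ n * (M * s) := by
    intro j
    have hb : ∀ p ∈ parabolicBoundary Ω T, |V (F.X j) p| ≤ n * (M * s) := by
      intro p hp
      have hx := (parabolicBoundary_subset Ω hT hp).1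
      calc |V (F.X j) p| ≤ ∑ i : Fin n, M * s := by
            refine (Finset.abs_sum_le_sum_abs _ _).trans (Finset.sum_le_sum fun i _ => ?_)
            rw [abs_mul]
            exact mul_le_mul (hM p.1 hx i j) (hDs i p hp) (abs_nonneg _)
              ((abs_nonneg _).trans (hM p.1 hx i j))
        _ = n * (M * s) := by simp
    intro p hp
    refine abs_le'.2 ⟨?_, ?_⟩
    · exact le_of_le_on_parabolicBoundary F hΩ hc hT hu.smooth hu.equation g (F.X j) (hVcont _)
        (hVu _) (fun q hq => (le_abs_self _).trans (hb q hq)) p hp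
    -- The lower bound is the upper bound for the opposite vector.
    · rw [← hVneg]
      refine le_of_le_on_parabolicBoundary F hΩ hc hT hu.smooth hu.equation g (-F.X j) (hVcont _)
        (hVu _) (fun q hq => ?_) p hp
      rw [hVneg]
      exact (neg_le_abs _).trans (hb q hq)
  have hDV : ∀ i, ∀ p ∈ cylinder Ω T,
      D i p = ∑ j, F.X.coord j (conjVector (g⁻¹ * p.1)⁻¹ (F.X i)) * V (F.X j) p := by
    intro i p hp
    have hC1 : ContMDiffAt 𝓘(ℝ, E) 𝓘(ℝ, ℝ) 1 (fun z => u (z, p.2)) p.1 :=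
      (contMDiffAt_slice (hu.smooth.contMDiffAt ((hΩ.prod isOpen_Ioo).mem_nhds hp))).of_le
        (by norm_num)
    -- The inverse adjoint action expresses the left frame at `p.1` through the right invariant
    -- fields, whose derivatives of `u` are already bounded.
    have h1 : F.X i = ∑ j, F.X.coord j (conjVector (g⁻¹ * p.1)⁻¹ (F.X i)) •
        conjVector (g⁻¹ * p.1) (F.X j) := by
      rw [← conjVector_sum_smul]
      have h2 := F.X.sum_repr (conjVector (g⁻¹ * p.1)⁻¹ (F.X i))
      simp only [Module.Basis.coord_apply, h2]
      exact (conjVector_conjVector_inv _ _).symm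
    rw [hDQ i p hp]
    conv_lhs => rw [h1]
    rw [leftDeriv_sum_smul]
    exact Finset.sum_congr rfl fun j _ => by rw [hVu _ p hp, rightDeriv_eq_leftDeriv g _ hC1]
  intro p hp
  have hx : p.1 ∈ closure Ω := subset_closure hp.1
  have hDle : ∀ i, |D i p| ≤ n * (M * (n * (M * s))) := by
    intro i
    rw [hDV i p hp]
    calc |∑ j, F.X.coord j (conjVector (g⁻¹ * p.1)⁻¹ (F.X i)) * V (F.X j) p|
        ≤ ∑ j : Fin n, M * (n * (M * s)) := by
          refine (Finset.abs_sum_le_sum_abs _ _).trans (Finset.sum_le_sum fun j _ => ?_)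
          rw [abs_mul]
          exact mul_le_mul (hM' p.1 hx i j) (hVle j p hp) (abs_nonneg _)
            ((abs_nonneg _).trans (hM' p.1 hx i j))
      _ = n * (M * (n * (M * s))) := by simp
  rw [hgrad p (cylinder_subset Ω T hp)]
  calc Real.sqrt (∑ i, D i p ^ 2) ≤ ∑ i, |D i p| := by
        refine Real.sqrt_le_iff.2 ⟨Finset.sum_nonneg fun i _ => abs_nonneg _, ?_⟩
        simpa only [sq_abs] using Finset.sum_sq_le_sq_sum_of_nonneg
          (s := Finset.univ) (f := fun i => |D i p|) (fun i _ => abs_nonneg _)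
    _ ≤ ∑ i : Fin n, n * (M * (n * (M * s))) := Finset.sum_le_sum fun i _ => hDle i
    _ = n * (n * (M * (n * (M * s)))) := by simp

theorem exists_bound_coord_conjVector [FiniteDimensional ℝ E] (F : StepTwoFrame E G n m)
    {B : Set G} (hB : IsCompact B) : ∃ M : ℝ, 0 ≤ M ∧ ∀ b ∈ B, ∀ i j,
      |F.X.coord i (conjVector b (F.X j))| ≤ M ∧ |F.X.coord j (conjVector b⁻¹ (F.X i))| ≤ M := by
  have : IsTopologicalGroup G := topologicalGroup_of_lieGroup 𝓘(ℝ, E) ∞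
  -- One continuous function dominates all the coefficients, so a single `M` serves for every pair
  -- of indices.
  have h : ContinuousOn (fun b : G => ∑ i, ∑ j, (|F.X.coord i (conjVector b (F.X j))| +
      |F.X.coord j (conjVector b⁻¹ (F.X i))|)) B := by
    refine Continuous.continuousOn ?_
    refine continuous_finsetSum _ fun i _ => continuous_finsetSum _ fun j _ => ?_
    exact (continuous_coord_conjVector _ _).abs.add
      ((continuous_coord_conjVector _ _).comp continuous_inv).abs
  obtain ⟨M, hM⟩ := hB.exists_bound_of_continuousOn h
  refine ⟨max M 0, le_max_right _ _, fun b hb i j => ?_⟩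
  have h1 := (le_abs_self _).trans (hM b hb)
  have h2 : |F.X.coord i (conjVector b (F.X j))| + |F.X.coord j (conjVector b⁻¹ (F.X i))| ≤ M := by
    refine le_trans ?_ h1
    refine le_trans ?_ (Finset.single_le_sum (f := fun i => ∑ j,
      (|F.X.coord i (conjVector b (F.X j))| + |F.X.coord j (conjVector b⁻¹ (F.X i))|))
      (fun i _ => Finset.sum_nonneg fun j _ => by positivity) (Finset.mem_univ i))
    exact Finset.single_le_sum (f := fun j =>
      |F.X.coord i (conjVector b (F.X j))| + |F.X.coord j (conjVector b⁻¹ (F.X i))|)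
      (fun j _ => by positivity) (Finset.mem_univ j)
  constructor
  · exact le_max_of_le_left (by linarith [abs_nonneg (F.X.coord j (conjVector b⁻¹ (F.X i)))])
  · exact le_max_of_le_left (by linarith [abs_nonneg (F.X.coord i (conjVector b (F.X j)))])

end MeanCurvatureFlow

/-! ### The uniform estimate -/

theorem mainTheorem7 {E G : Type*} [NormedAddCommGroup E] [NormedSpace ℝ E]
    [FiniteDimensional ℝ E] [TopologicalSpace G] [ChartedSpace E G] [Group G]
    [LieGroup 𝓘(ℝ, E) ∞ G] {n m : ℕ} (F : StepTwoFrame E G n m)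
    (B : Set G) (hB : IsCompact B) :
    ∃ C : ℝ≥0, 0 < C ∧
      ∀ (Ω : Set G) (g : G), IsOpen Ω → Ω ⊆ g • B →
      ∀ (T : ℝ), 0 < T → ∀ (ε : ℝ), 0 < ε →
      ∀ (φ : G → ℝ) (u : G × ℝ → ℝ), MeanCurvatureFlow.IsSolution F ε Ω T φ u →
      ∀ K : Set G, IsCompact K → K ⊆ Ω →
        (⨆ p ∈ K ×ˢ Ico (0 : ℝ) T, ENNReal.ofReal (MeanCurvatureFlow.spaceGrad F Ω T u p)) ≤
          C * ⨆ p ∈ MeanCurvatureFlow.parabolicBoundary Ω T,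
            ENNReal.ofReal (MeanCurvatureFlow.spaceGrad F Ω T u p +
              MeanCurvatureFlow.timeSpeed Ω T u p) := by
  open MeanCurvatureFlow in
  have : IsTopologicalGroup G := topologicalGroup_of_lieGroup 𝓘(ℝ, E) ∞
  have : T2Space G := t2Space_of_isTopologicalGroup_of_chartedSpace E G
  obtain ⟨M, hM0, hM⟩ := exists_bound_coord_conjVector F hB
  -- The factor from `spaceGrad_le_of_bound`, plus `1`: this gives `c ≥ 1`, which covers the points
  -- of `K × {0}` and makes `c * ⊤ = ⊤`.
  set c : ℝ≥0 := n * (n * (M.toNNReal * (n * M.toNNReal))) + 1 with hc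
  refine ⟨c, by positivity, ?_⟩
  intro Ω g hΩ hΩB T hT ε _ φ u hu K _ hKΩ
  set S := ⨆ p ∈ parabolicBoundary Ω T,
    ENNReal.ofReal (spaceGrad F Ω T u p + timeSpeed Ω T u p) with hS
  have hc1 : (1 : ℝ≥0) ≤ c := le_add_of_nonneg_left zero_le
  rcases eq_or_ne S ⊤ with hS' | hS'
  · rw [hS', ENNReal.mul_top (by exact_mod_cast (one_pos.trans_le hc1).ne')]
    exact le_top
  have hgB : IsCompact (g • B) := hB.smul g
  have hcl : closure Ω ⊆ g • B := closure_minimal hΩB hgB.isClosed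
  have hcomp : IsCompact (closure Ω) := hgB.of_isClosed_subset isClosed_closure hcl
  have hmem : ∀ x ∈ closure Ω, g⁻¹ * x ∈ B := fun x hx => by
    have := mem_smul_set_iff_inv_smul_mem.1 (hcl hx)
    rwa [smul_eq_mul] at this
  have hs : ∀ p ∈ parabolicBoundary Ω T, spaceGrad F Ω T u p ≤ S.toReal := by
    intro p hp
    have h1 : ENNReal.ofReal (spaceGrad F Ω T u p + timeSpeed Ω T u p) ≤ S :=
      le_iSup₂ (f := fun p (_ : p ∈ parabolicBoundary Ω T) =>
        ENNReal.ofReal (spaceGrad F Ω T u p + timeSpeed Ω T u p)) p hp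
    have h2 := (ENNReal.ofReal_le_iff_le_toReal hS').1 h1
    -- The time speed is nonnegative, so it can be dropped from the sum.
    linarith [timeSpeed_nonneg hT hu.time_extends hp]
  have hQ := spaceGrad_le_of_bound F hΩ hcomp hT hu g
    (fun x hx i j => (hM _ (hmem x hx) i j).1) (fun x hx i j => (hM _ (hmem x hx) i j).2) hs
  have hS0 : 0 ≤ S.toReal := ENNReal.toReal_nonneg
  have hcS : (c : ℝ≥0∞) * S = ENNReal.ofReal (c * S.toReal) := by
    rw [ENNReal.ofReal_mul c.coe_nonneg, ENNReal.ofReal_coe_nnreal, ENNReal.ofReal_toReal hS']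
  rw [hcS]
  refine iSup₂_le fun p hp => ENNReal.ofReal_le_ofReal ?_
  -- Points with `t = 0` lie on the parabolic boundary itself; the others lie in `Q`, where the
  -- maximum principle applies.
  rcases hp.2.1.eq_or_lt with h0 | h0
  · refine (hs p (Or.inl ⟨hKΩ hp.1, h0.symm⟩)).trans ?_
    exact le_mul_of_one_le_left hS0 (by exact_mod_cast hc1)
  · refine (hQ p ⟨hKΩ hp.1, h0, hp.2.2⟩).trans ?_
    have : (c : ℝ) = n * (n * (M * (n * M))) + 1 := by
      rw [hc]; push_cast; rw [Real.coe_toNNReal M hM0]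
    rw [this]
    linarith
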